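/- Let $k$ be a field of characteristic zero, let $H$ be a finite group and let $\alpha\in Z^3(H,k^*)$ be a normalised 3-cocycle, i.e. $\alpha(g,h,l)\,\alpha(f,gh,l)\,\alpha(f,g,h)=\alpha(fg,h,l)\,\alpha(f,g,hl)$ and $\alpha(f,g,h)=1$ whenever one of $f,g,h$ is the identity $e$ (for instance, $H$ is a subgroup of a finite group $G$ and $\alpha$ is the restriction to $H$ of a normalised 3-cocycle on $G$). Put $$\alpha(f,g|h)=\alpha(f,g,h)^{-1}\alpha(f,ghg^{-1},g)\,\alpha(fgh(fg)^{-1},f,g)^{-1},\qquad \alpha(f|g,h)=\alpha(f,g,h)\,\alpha(fgf^{-1},f,h)^{-1}\alpha(fgf^{-1},fhf^{-1},f).$$ Let $\mathcal Z(H,\alpha)$ be the following braided monoidal category. Its objects are finite-dimensional $H$-graded $k$-vector spaces $V=\bigoplus_{h\in H}V_h$ with linear automorphisms $v\mapsto f.v$ ($f\in H$) such that $f.V_g=V_{fgf^{-1}}$ and $(fg).v=\alpha(f,g|h)\,f.(g.v)$ for $v\in V_h$; morphisms are the linear maps preserving the grading and the action. The tensor product is the graded tensor product with $f.(x\otimes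 y)=\alpha(f|g,h)\,(f.x\otimes f.y)$ for $x\in X_g$, $y\in Y_h$; the unit is $k$ in degree $e$ with trivial action; the associativity constraint is $u\otimes(v\otimes w)\mapsto\alpha(f,g,h)\,(u\otimes v)\otimes w$ for $u\in U_f$, $v\in V_g$, $w\in W_h$; the braiding is $x\otimes y\mapsto f.y\otimes x$ for $x\in X_f$. Let $F\trianglelefteq H$ be a normal subgroup and let $\gamma:F\times F\to k^*$ and $\varepsilon:H\times F\to k^*$, $(h,f)\mapsto\varepsilon_h(f)$, satisfy, for all $f,f',f''\in F$ and $g,h\in H$, $$\gamma(f',f'')\,\gamma(ff',f'')^{-1}\,\gamma(f,f'f'')\,\gamma(f,f')^{-1}=\alpha(f,f',f''),\qquad \varepsilon_{gh}(f)=\alpha(g,h|f)\,\varepsilon_g(hfh^{-1})\,\varepsilon_h(f),$$ $$\gamma(f,f')\,\varepsilon_h(ff')=\alpha(h|f,f')\,\varepsilon_h(f)\,\varepsilon_h(f')\,\gamma(hfh^{-1},hf'h^{-1}),\qquad \gamma(f,f')=\varepsilon_f(f')\,\gamma(ff'f^{-1},f).$$ Let $k[F,\gamma,\varepsilon]$ be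 the corresponding etale (indecomposable, commutative, separable) algebra in $\mathcal Z(H,\alpha)$: it has a basis $e_f$ ($f\in F$) with $e_f$ of degree $f$, action $h.e_f=\varepsilon_h(f)\,e_{hfh^{-1}}$, multiplication $e_fe_{f'}=\gamma(f,f')\,e_{ff'}$, and unit $\gamma(e,e)^{-1}e_e$. A commutative algebra $A$ in an additive braided monoidal category with braiding $c$ is called Lagrangian if every local right $A$-module is a direct sum of (finitely many, possibly zero) copies of the regular module $A$; here modules are unital, and a right module $\nu:M\otimes A\to M$ is local if $\nu\circ c_{A,M}\circ c_{M,A}=\nu$. Then $k[F,\gamma,\varepsilon]$ is Lagrangian in $\mathcal Z(H,\alpha)$ if and only if $F=H$. -/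

import Mathlib

set_option linter.unusedSectionVars false
set_option linter.unusedSimpArgs false

open scoped TensorProduct

universe u v

/-- A normalised `3`-cocycle of `G` with values in the multiplicative group `kˣ`. -/
structure NormCocycle (k : Type*) [Field k] (G : Type*) [Group G] where
  toFun : G → G → G → kˣ
  cocycle : ∀ f g h l : G,
    toFun g h l * toFun f (g * h) l * toFun f g h = toFun (f * g) h l * toFun f g (h * l)
  one_left : ∀ g h : G, toFun 1 g h = 1
  one_mid : ∀ f h : G, toFun f 1 h = 1
  one_right : ∀ f g : G, toFun f g 1 = 1

namespace NormCocycle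

variable {k : Type*} [Field k] {G : Type*} [Group G] (α : NormCocycle k G)

/-- `α(f, g | h) = α(f, g, h)⁻¹ α(f, ghg⁻¹, g) α(fgh(fg)⁻¹, f, g)⁻¹`. -/
def actTwist (f g h : G) : kˣ :=
  (α.toFun f g h)⁻¹ * α.toFun f (g * h * g⁻¹) g * (α.toFun (f * g * h * (f * g)⁻¹) f g)⁻¹

/-- `α(f | g, h) = α(f, g, h) α(fgf⁻¹, f, h)⁻¹ α(fgf⁻¹, fhf⁻¹, f)`. -/
def tensorTwist (f g h : G) : kˣ :=
  α.toFun f g h * (α.toFun (f * g * f⁻¹) f h)⁻¹ *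
    α.toFun (f * g * f⁻¹) (f * h * f⁻¹) f

theorem actTwist_eq {f g h a b : G} (ha : a * g = g * h) (hb : b * f = f * a) :
    α.actTwist f g h = (α.toFun f g h)⁻¹ * α.toFun f a g * (α.toFun b f g)⁻¹ := by
  have e1 : g * h * g⁻¹ = a := by rw [← ha]; group
  have e2 : f * g * h * (f * g)⁻¹ = b := by
    have : b = f * a * f⁻¹ := by rw [← hb]; group
    rw [this, ← e1]; group
  rw [actTwist, e1, e2]

theorem tensorTwist_eq {f g h a b : G} (ha : a * f = f * g) (hb : b * f = f * h) :
    α.tensorTwist f g h = α.toFun f g h * (α.toFun a f h)⁻¹ * α.toFun a b f := by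
  have e1 : f * g * f⁻¹ = a := by rw [← ha]; group
  have e2 : f * h * f⁻¹ = b := by rw [← hb]; group
  rw [tensorTwist, e1, e2]

theorem val_cocycle (f g h l : G) :
    Additive.ofMul (α.toFun g h l) + Additive.ofMul (α.toFun f (g * h) l)
      + Additive.ofMul (α.toFun f g h)
      = Additive.ofMul (α.toFun (f * g) h l) + Additive.ofMul (α.toFun f g (h * l)) :=
  α.cocycle f g h l

@[simp] theorem actTwist_one_one (g : G) : α.actTwist 1 1 g = 1 := by
  simp [actTwist, α.one_left, α.one_mid, α.one_right]

@[simp] theorem actTwist_one (f g : G) : α.actTwist f g 1 = 1 := by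
  simp [actTwist, α.one_left, α.one_mid, α.one_right]

@[simp] theorem tensorTwist_one (g h : G) : α.tensorTwist 1 g h = 1 := by
  simp [tensorTwist, α.one_left, α.one_mid, α.one_right]

@[simp] theorem tensorTwist_one_left (f h : G) : α.tensorTwist f 1 h = 1 := by
  simp [tensorTwist, α.one_left, α.one_mid, α.one_right]

@[simp] theorem tensorTwist_one_right (f g : G) : α.tensorTwist f g 1 = 1 := by
  simp [tensorTwist, α.one_left, α.one_mid, α.one_right]

theorem actTwist_tensorTwist (f g u v : G) :
    α.tensorTwist (f * g) u v * (α.actTwist f g u * α.actTwist f g v) =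
      α.actTwist f g (u * v) * (α.tensorTwist g u v *
        α.tensorTwist f (g * u * g⁻¹) (g * v * g⁻¹)) := by
  obtain ⟨u1, hu1⟩ : ∃ x, x = g * u * g⁻¹ := ⟨_, rfl⟩
  obtain ⟨v1, hv1⟩ : ∃ x, x = g * v * g⁻¹ := ⟨_, rfl⟩
  obtain ⟨u2, hu2⟩ : ∃ x, x = f * u1 * f⁻¹ := ⟨_, rfl⟩
  obtain ⟨v2, hv2⟩ : ∃ x, x = f * v1 * f⁻¹ := ⟨_, rfl⟩
  have a1 : u1 * g = g * u := by rw [hu1]; group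
  have a2 : v1 * g = g * v := by rw [hv1]; group
  have a3 : u2 * f = f * u1 := by rw [hu2]; group
  have a4 : v2 * f = f * v1 := by rw [hv2]; group
  rw [← hu1, ← hv1,
    α.tensorTwist_eq (f := f * g) (g := u) (h := v) (a := u2) (b := v2)
      (by rw [← mul_assoc, a3, mul_assoc, a1, mul_assoc])
      (by rw [← mul_assoc, a4, mul_assoc, a2, mul_assoc]),
    α.actTwist_eq a1 a3, α.actTwist_eq a2 a4,
    α.actTwist_eq (f := f) (g := g) (h := u * v) (a := u1 * v1) (b := u2 * v2)
      (by rw [mul_assoc, a2, ← mul_assoc, a1, mul_assoc])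
      (by rw [mul_assoc, a4, ← mul_assoc, a3, mul_assoc]),
    α.tensorTwist_eq a1 a2, α.tensorTwist_eq a3 a4]
  have c1 := α.val_cocycle f g u v
  have c2 := α.val_cocycle f u1 g v
  have c3 := α.val_cocycle u2 f g v
  have c4 := α.val_cocycle f u1 v1 g
  have c5 := α.val_cocycle u2 f v1 g
  have c6 := α.val_cocycle u2 v2 f g
  apply Additive.ofMul.injective
  simp only [ofMul_mul, ofMul_inv]
  simp only [a1, a2, a3, a4] at c1 c2 c3 c4 c5 c6
  linear_combination (norm := abel) (-1 : ℤ) • c1 + c2 - c3 - c4 + c5 - c6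

theorem tensorTwist_assoc (f g h u : G) :
    α.toFun g h u * (α.tensorTwist f (g * h) u * α.tensorTwist f g h) =
      α.tensorTwist f g (h * u) * α.tensorTwist f h u *
        α.toFun (f * g * f⁻¹) (f * h * f⁻¹) (f * u * f⁻¹) := by
  obtain ⟨g1, hg1⟩ : ∃ x, x = f * g * f⁻¹ := ⟨_, rfl⟩
  obtain ⟨h1, hh1⟩ : ∃ x, x = f * h * f⁻¹ := ⟨_, rfl⟩
  obtain ⟨u1, hu1⟩ : ∃ x, x = f * u * f⁻¹ := ⟨_, rfl⟩
  have a1 : g1 * f = f * g := by rw [hg1]; group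
  have a2 : h1 * f = f * h := by rw [hh1]; group
  have a3 : u1 * f = f * u := by rw [hu1]; group
  rw [← hg1, ← hh1, ← hu1, α.tensorTwist_eq a1 a2, α.tensorTwist_eq a2 a3,
    α.tensorTwist_eq (f := f) (g := g * h) (h := u) (a := g1 * h1) (b := u1)
      (by rw [mul_assoc, a2, ← mul_assoc, a1, mul_assoc]) a3,
    α.tensorTwist_eq (f := f) (g := g) (h := h * u) (a := g1) (b := h1 * u1) a1
      (by rw [mul_assoc, a3, ← mul_assoc, a2, mul_assoc])]
  have c1 := α.val_cocycle f g h u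
  have c2 := α.val_cocycle g1 f h u
  have c3 := α.val_cocycle g1 h1 f u
  have c4 := α.val_cocycle g1 h1 u1 f
  apply Additive.ofMul.injective
  simp only [ofMul_mul, ofMul_inv]
  simp only [a1, a2, a3] at c1 c2 c3 c4
  linear_combination (norm := abel) c1 - c2 + c3 - c4

theorem actTwist_braid (g f h : G) :
    α.actTwist (g * f * g⁻¹) g h * α.tensorTwist g (f * h * f⁻¹) f =
      α.actTwist g f h * α.tensorTwist g f h := by
  obtain ⟨a, ha⟩ : ∃ x, x = f * h * f⁻¹ := ⟨_, rfl⟩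
  obtain ⟨b, hb⟩ : ∃ x, x = g * a * g⁻¹ := ⟨_, rfl⟩
  obtain ⟨h1, hh1⟩ : ∃ x, x = g * h * g⁻¹ := ⟨_, rfl⟩
  obtain ⟨f1, hf1⟩ : ∃ x, x = g * f * g⁻¹ := ⟨_, rfl⟩
  have a1 : a * f = f * h := by rw [ha]; group
  have a2 : b * g = g * a := by rw [hb]; group
  have a3 : h1 * g = g * h := by rw [hh1]; group
  have a4 : f1 * g = g * f := by rw [hf1]; group
  have a5 : b * f1 = f1 * h1 := by
    rw [← mul_left_inj g, mul_assoc, a4, ← mul_assoc, a2, mul_assoc, a1, mul_assoc, a3,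
      ← mul_assoc, ← mul_assoc, a4]
  rw [← ha, ← hf1, α.actTwist_eq a3 a5, α.actTwist_eq a1 a2, α.tensorTwist_eq a2 a4,
    α.tensorTwist_eq a4 a3]
  apply Additive.ofMul.injective
  simp only [ofMul_mul, ofMul_inv]
  abel

end NormCocycle

/-- An object of `𝒵(G, α)`: a finite-dimensional `G`-graded vector space with an `α`-projective
`G`-action.  The grading `V = ⨁ V_g` is recorded by the projections `pr g : V → V` onto the
homogeneous components, so `V_g = {v | pr g v = v}`.  Given `act_mul`, the condition `act 1 = 1`
says precisely that every `act f` is invertible. -/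
structure TwistedCenter (k : Type u) [Field k] (G : Type v) [Group G] [Fintype G]
    (α : NormCocycle k G) where
  carrier : Type (max u v)
  [addCommGroup : AddCommGroup carrier]
  [module : Module k carrier]
  [finite : Module.Finite k carrier]
  pr : G → Module.End k carrier
  pr_complete : CompleteOrthogonalIdempotents pr
  act : G → Module.End k carrier
  act_pr : ∀ (f g : G) (v : carrier), act f (pr g v) = pr (f * g * f⁻¹) (act f v)
  act_one : act 1 = 1
  act_mul : ∀ (f g h : G) (v : carrier),
    act (f * g) (pr h v) = (α.actTwist f g h : k) • act f (act g (pr h v))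

namespace TwistedCenter

variable {k : Type u} [Field k] {G : Type v} [Group G] [Fintype G] {α : NormCocycle k G}

attribute [instance] TwistedCenter.addCommGroup TwistedCenter.module TwistedCenter.finite

section Linear

variable (X Y Z W : TwistedCenter k G α)

theorem sum_pr (x : X.carrier) : ∑ g, X.pr g x = x := by
  have := congrArg (fun φ : Module.End k X.carrier => φ x) X.pr_complete.complete
  simpa [LinearMap.sum_apply] using this

theorem pr_pr (g : G) (x : X.carrier) : X.pr g (X.pr g x) = X.pr g x :=
  congrArg (fun φ : Module.End k X.carrier => φ x) (X.pr_complete.idem g)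

variable {X Y Z W}

theorem pr_ne {g h : G} {x : X.carrier} (hx : X.pr g x = x) (hn : h ≠ g) : X.pr h x = 0 := by
  rw [← hx]
  exact congrArg (fun φ : Module.End k X.carrier => φ x) (X.pr_complete.ortho hn)

theorem act_homog (f : G) {g : G} {x : X.carrier} (hx : X.pr g x = x) :
    X.pr (f * g * f⁻¹) (X.act f x) = X.act f x := by
  rw [← X.act_pr, hx]

theorem act_mul_homog (f g : G) {h : G} {x : X.carrier} (hx : X.pr h x = x) :
    X.act (f * g) x = (α.actTwist f g h : k) • X.act f (X.act g x) := by
  have := X.act_mul f g h x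
  rwa [hx] at this

theorem lin_ext {M : Type*} [AddCommGroup M] [Module k M] {φ ψ : X.carrier →ₗ[k] M}
    (h : ∀ (g : G) (x : X.carrier), X.pr g x = x → φ x = ψ x) : φ = ψ := by
  ext x
  rw [← X.sum_pr x, map_sum, map_sum]
  exact Finset.sum_congr rfl fun g _ => h g _ (X.pr_pr g x)

theorem lin_ext₂ {M : Type*} [AddCommGroup M] [Module k M]
    {φ ψ : X.carrier ⊗[k] Y.carrier →ₗ[k] M}
    (h : ∀ (f g : G) (x : X.carrier) (y : Y.carrier), X.pr f x = x → Y.pr g y = y →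
      φ (x ⊗ₜ y) = ψ (x ⊗ₜ y)) : φ = ψ :=
  TensorProduct.ext <| lin_ext fun f x hx => lin_ext fun g y hy => h f g x y hx hy

theorem lin_ext₃ {M : Type*} [AddCommGroup M] [Module k M]
    {φ ψ : (X.carrier ⊗[k] Y.carrier) ⊗[k] Z.carrier →ₗ[k] M}
    (h : ∀ (f g h : G) (x : X.carrier) (y : Y.carrier) (z : Z.carrier),
      X.pr f x = x → Y.pr g y = y → Z.pr h z = z →
      φ ((x ⊗ₜ y) ⊗ₜ z) = ψ ((x ⊗ₜ y) ⊗ₜ z)) : φ = ψ :=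
  TensorProduct.ext <| lin_ext₂ fun f g x y hx hy => lin_ext fun l z hz => h f g l x y z hx hy hz

theorem lin_ext₃' {M : Type*} [AddCommGroup M] [Module k M]
    {φ ψ : X.carrier ⊗[k] (Y.carrier ⊗[k] Z.carrier) →ₗ[k] M}
    (h : ∀ (f g h : G) (x : X.carrier) (y : Y.carrier) (z : Z.carrier),
      X.pr f x = x → Y.pr g y = y → Z.pr h z = z →
      φ (x ⊗ₜ (y ⊗ₜ z)) = ψ (x ⊗ₜ (y ⊗ₜ z))) : φ = ψ :=
  TensorProduct.ext <| lin_ext fun f x hx => lin_ext₂ fun g l y z hy hz => h f g l x y z hx hy hz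

variable (X Y Z W)

/-- The projections of `X ⊗ Y`: `(X ⊗ Y)_f = ⨁_{gh = f} X_g ⊗ Y_h`. -/
noncomputable def tensorPr (f : G) : Module.End k (X.carrier ⊗[k] Y.carrier) :=
  ∑ g, TensorProduct.map (X.pr g) (Y.pr (g⁻¹ * f))

/-- The action on `X ⊗ Y`: `f.(x ⊗ y) = α(f | g, h) (f.x ⊗ f.y)` for `x ∈ X_g`, `y ∈ Y_h`. -/
noncomputable def tensorAct (f : G) : Module.End k (X.carrier ⊗[k] Y.carrier) :=
  ∑ g, ∑ h, (α.tensorTwist f g h : k) •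
    TensorProduct.map (X.act f ∘ₗ X.pr g) (Y.act f ∘ₗ Y.pr h)

/-- `(x ⊗ y) ⊗ z ↦ α(f, g, h)⁻¹ x ⊗ (y ⊗ z)` for `x ∈ X_f`, `y ∈ Y_g`, `z ∈ Z_h`. -/
noncomputable def assocLin : (X.carrier ⊗[k] Y.carrier) ⊗[k] Z.carrier →ₗ[k]
    X.carrier ⊗[k] (Y.carrier ⊗[k] Z.carrier) :=
  ∑ f, ∑ g, ∑ h, (((α.toFun f g h)⁻¹ : kˣ) : k) •
    ((TensorProduct.assoc k X.carrier Y.carrier Z.carrier).toLinearMap ∘ₗ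
      TensorProduct.map (TensorProduct.map (X.pr f) (Y.pr g)) (Z.pr h))

/-- `x ⊗ (y ⊗ z) ↦ α(f, g, h) (x ⊗ y) ⊗ z` for `x ∈ X_f`, `y ∈ Y_g`, `z ∈ Z_h`. -/
noncomputable def assocInvLin : X.carrier ⊗[k] (Y.carrier ⊗[k] Z.carrier) →ₗ[k]
    (X.carrier ⊗[k] Y.carrier) ⊗[k] Z.carrier :=
  ∑ f, ∑ g, ∑ h, (α.toFun f g h : k) •
    ((TensorProduct.assoc k X.carrier Y.carrier Z.carrier).symm.toLinearMap ∘ₗ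
      TensorProduct.map (X.pr f) (TensorProduct.map (Y.pr g) (Z.pr h)))

/-- The braiding `x ⊗ y ↦ f.y ⊗ x` for `x ∈ X_f`. -/
noncomputable def braidLin : X.carrier ⊗[k] Y.carrier →ₗ[k] Y.carrier ⊗[k] X.carrier :=
  ∑ f, TensorProduct.map (Y.act f) (X.pr f) ∘ₗ (TensorProduct.comm k X.carrier Y.carrier).toLinearMap

/-- The inverse of the operator `act f`. -/
noncomputable def actInv (f : G) : Module.End k X.carrier :=
  ∑ h, (α.actTwist f⁻¹ f (f⁻¹ * h * f) : k) • (X.act f⁻¹ ∘ₗ X.pr h)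

/-- The inverse braiding `y ⊗ x ↦ x ⊗ f⁻¹(y)` for `x ∈ X_f`. -/
noncomputable def braidInvLin : Y.carrier ⊗[k] X.carrier →ₗ[k] X.carrier ⊗[k] Y.carrier :=
  ∑ f, (TensorProduct.comm k Y.carrier X.carrier).toLinearMap ∘ₗ
    TensorProduct.map (Y.actInv f) (X.pr f)

variable {X Y Z W}

theorem tensorPr_tmul {g h : G} {x : X.carrier} {y : Y.carrier} (hx : X.pr g x = x)
    (hy : Y.pr h y = y) : tensorPr X Y (g * h) (x ⊗ₜ y) = x ⊗ₜ y := by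
  rw [tensorPr, LinearMap.sum_apply, Finset.sum_eq_single g]
  · simp [hx, hy]
  · intro b _ hb
    simp [pr_ne hx hb]
  · simp

theorem tensorPr_tmul_ne {f g h : G} {x : X.carrier} {y : Y.carrier} (hx : X.pr g x = x)
    (hy : Y.pr h y = y) (hf : f ≠ g * h) : tensorPr X Y f (x ⊗ₜ y) = 0 := by
  rw [tensorPr, LinearMap.sum_apply, Finset.sum_eq_zero]
  intro b _
  by_cases hb : b = g
  · subst hb
    have : b⁻¹ * f ≠ h := by
      rintro rfl
      exact hf (by group)
    simp [pr_ne hy this]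
  · simp [pr_ne hx hb]

theorem tensorAct_tmul (f : G) {g h : G} {x : X.carrier} {y : Y.carrier} (hx : X.pr g x = x)
    (hy : Y.pr h y = y) :
    tensorAct X Y f (x ⊗ₜ y) = (α.tensorTwist f g h : k) • (X.act f x ⊗ₜ Y.act f y) := by
  rw [tensorAct, LinearMap.sum_apply, Finset.sum_eq_single g]
  · rw [LinearMap.sum_apply, Finset.sum_eq_single h]
    · simp [hx, hy]
    · intro b _ hb
      simp [pr_ne hy hb]
    · simp
  · intro b _ hb
    simp [pr_ne hx hb, LinearMap.sum_apply]
  · simp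

theorem assocLin_tmul {f g h : G} {x : X.carrier} {y : Y.carrier} {z : Z.carrier}
    (hx : X.pr f x = x) (hy : Y.pr g y = y) (hz : Z.pr h z = z) :
    assocLin X Y Z ((x ⊗ₜ y) ⊗ₜ z) = (((α.toFun f g h)⁻¹ : kˣ) : k) • (x ⊗ₜ (y ⊗ₜ z)) := by
  rw [assocLin, LinearMap.sum_apply, Finset.sum_eq_single f]
  · rw [LinearMap.sum_apply, Finset.sum_eq_single g]
    · rw [LinearMap.sum_apply, Finset.sum_eq_single h]
      · simp [hx, hy, hz]
      · intro b _ hb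
        simp [pr_ne hz hb]
      · simp
    · intro b _ hb
      simp [pr_ne hy hb, LinearMap.sum_apply]
    · simp
  · intro b _ hb
    simp [pr_ne hx hb, LinearMap.sum_apply]
  · simp

theorem assocInvLin_tmul {f g h : G} {x : X.carrier} {y : Y.carrier} {z : Z.carrier}
    (hx : X.pr f x = x) (hy : Y.pr g y = y) (hz : Z.pr h z = z) :
    assocInvLin X Y Z (x ⊗ₜ (y ⊗ₜ z)) = (α.toFun f g h : k) • ((x ⊗ₜ y) ⊗ₜ z) := by
  rw [assocInvLin, LinearMap.sum_apply, Finset.sum_eq_single f]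
  · rw [LinearMap.sum_apply, Finset.sum_eq_single g]
    · rw [LinearMap.sum_apply, Finset.sum_eq_single h]
      · simp [hx, hy, hz]
      · intro b _ hb
        simp [pr_ne hz hb]
      · simp
    · intro b _ hb
      simp [pr_ne hy hb, LinearMap.sum_apply]
    · simp
  · intro b _ hb
    simp [pr_ne hx hb, LinearMap.sum_apply]
  · simp

theorem braidLin_tmul {f : G} {x : X.carrier} (hx : X.pr f x = x) (y : Y.carrier) :
    braidLin X Y (x ⊗ₜ y) = Y.act f y ⊗ₜ x := by
  rw [braidLin, LinearMap.sum_apply, Finset.sum_eq_single f]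
  · simp [hx]
  · intro b _ hb
    simp [pr_ne hx hb]
  · simp

theorem braidInvLin_tmul {f : G} {x : X.carrier} (hx : X.pr f x = x) (y : Y.carrier) :
    braidInvLin X Y (y ⊗ₜ x) = x ⊗ₜ Y.actInv f y := by
  rw [braidInvLin, LinearMap.sum_apply, Finset.sum_eq_single f]
  · simp [hx]
  · intro b _ hb
    simp [pr_ne hx hb]
  · simp

theorem actInv_act (f : G) (x : X.carrier) : X.actInv f (X.act f x) = x := by
  suffices h : X.actInv f ∘ₗ X.act f = LinearMap.id from
    congrArg (fun φ : Module.End k X.carrier => φ x) h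
  refine lin_ext fun g x hx => ?_
  have h1 := act_homog f hx
  rw [LinearMap.comp_apply, actInv, LinearMap.sum_apply, Finset.sum_eq_single (f * g * f⁻¹)]
  · have h2 : f⁻¹ * (f * g * f⁻¹) * f = g := by group
    rw [h2, LinearMap.smul_apply, LinearMap.comp_apply, h1, ← act_mul_homog _ _ hx,
      inv_mul_cancel, act_one]
    rfl
  · intro b _ hb
    simp [pr_ne h1 hb]
  · simp

theorem act_actInv (f : G) (x : X.carrier) : X.act f (X.actInv f x) = x := by
  have h : X.actInv f * X.act f = 1 := LinearMap.ext (actInv_act f)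
  exact congrArg (fun φ : Module.End k X.carrier => φ x) (mul_eq_one_comm.mp h)

variable (X Y)

/-- The tensor product of objects. -/
noncomputable abbrev tensorObj : TwistedCenter k G α where
  carrier := X.carrier ⊗[k] Y.carrier
  pr := tensorPr X Y
  pr_complete := by
    classical
    have key : ∀ f f' : G, tensorPr X Y f * tensorPr X Y f' =
        if f = f' then tensorPr X Y f' else 0 := by
      intro f f'
      refine lin_ext₂ fun g h x y hx hy => ?_
      rw [Module.End.mul_apply]
      by_cases h1 : f' = g * h
      · subst h1
        rw [tensorPr_tmul hx hy]
        split_ifs with h2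
        · subst h2; rfl
        · rw [tensorPr_tmul_ne hx hy h2]; rfl
      · rw [tensorPr_tmul_ne hx hy h1, map_zero]
        split_ifs with h2
        · rw [tensorPr_tmul_ne hx hy h1]
        · rfl
    refine ⟨⟨fun f => ?_, fun f f' hf => ?_⟩, ?_⟩
    · exact (key f f).trans (if_pos rfl)
    · exact (key f f').trans (if_neg hf)
    · refine lin_ext₂ fun g h x y hx hy => ?_
      rw [LinearMap.sum_apply, Finset.sum_eq_single (g * h)]
      · rw [tensorPr_tmul hx hy]; rfl
      · intro b _ hb
        exact tensorPr_tmul_ne hx hy hb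
      · simp
  act := tensorAct X Y
  act_pr := by
    intro f g v
    suffices h : tensorAct X Y f ∘ₗ tensorPr X Y g =
        tensorPr X Y (f * g * f⁻¹) ∘ₗ tensorAct X Y f from
      congrArg (fun φ : Module.End k _ => φ v) h
    refine lin_ext₂ fun a b x y hx hy => ?_
    rw [LinearMap.comp_apply, LinearMap.comp_apply, tensorAct_tmul f hx hy, map_smul]
    have h1 := act_homog f hx
    have h2 := act_homog f hy
    by_cases hg : g = a * b
    · subst hg
      have : f * (a * b) * f⁻¹ = (f * a * f⁻¹) * (f * b * f⁻¹) := by group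
      rw [this, tensorPr_tmul h1 h2, tensorPr_tmul hx hy, tensorAct_tmul f hx hy]
    · have : f * g * f⁻¹ ≠ (f * a * f⁻¹) * (f * b * f⁻¹) := by
        intro e
        apply hg
        have e' : f * g * f⁻¹ = f * (a * b) * f⁻¹ := by rw [e]; group
        exact mul_left_cancel (mul_right_cancel e')
      rw [tensorPr_tmul_ne h1 h2 this, tensorPr_tmul_ne hx hy hg, map_zero, smul_zero]
  act_one := by
    refine lin_ext₂ fun a b x y hx hy => ?_
    rw [tensorAct_tmul 1 hx hy]
    simp [act_one]
  act_mul := by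
    intro f g h v
    suffices e : tensorAct X Y (f * g) ∘ₗ tensorPr X Y h =
        (α.actTwist f g h : k) • (tensorAct X Y f ∘ₗ tensorAct X Y g ∘ₗ tensorPr X Y h) from
      congrArg (fun φ : Module.End k _ => φ v) e
    refine lin_ext₂ fun a b x y hx hy => ?_
    simp only [LinearMap.comp_apply, LinearMap.smul_apply]
    by_cases hh : h = a * b
    · subst hh
      rw [tensorPr_tmul hx hy, tensorAct_tmul _ hx hy, tensorAct_tmul _ hx hy, map_smul,
        tensorAct_tmul _ (act_homog g hx) (act_homog g hy), act_mul_homog f g hx,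
        act_mul_homog f g hy, TensorProduct.smul_tmul_smul]
      simp only [smul_smul]
      congr 1
      exact_mod_cast congrArg Units.val (α.actTwist_tensorTwist f g a b)
    · rw [tensorPr_tmul_ne hx hy hh]
      simp

/-- The monoidal unit: the one-dimensional space `k` in degree `1` with trivial action. -/
noncomputable abbrev unitObj (α : NormCocycle k G) : TwistedCenter k G α where
  carrier := ULift.{v} k
  pr := open Classical in fun g => if g = 1 then 1 else 0
  pr_complete := by
    classical
    refine ⟨⟨fun f => ?_, fun f f' hf => ?_⟩, ?_⟩
    · show _ * _ = _
      split_ifs <;> simp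
    · show _ * _ = _
      split_ifs with h1 h2
      · exact absurd (h1.trans h2.symm) hf
      all_goals simp
    · simp
  act := fun _ => 1
  act_pr := by
    intro f g v
    by_cases hg : g = 1 <;> simp [hg]
  act_one := rfl
  act_mul := by
    intro f g h v
    by_cases hh : h = 1
    · subst hh; simp
    · simp [hh]

end Linear

end TwistedCenter

namespace TwistedCenter

variable {k : Type u} [Field k] {G : Type v} [Group G] [Fintype G] {α : NormCocycle k G}

open CategoryTheory

/-- Morphisms of `𝒵(G, α)`: linear maps preserving the grading and the action. -/
@[ext]
structure Hom (X Y : TwistedCenter k G α) where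
  lin : X.carrier →ₗ[k] Y.carrier
  lin_pr : ∀ (g : G) (x : X.carrier), lin (X.pr g x) = Y.pr g (lin x)
  lin_act : ∀ (g : G) (x : X.carrier), lin (X.act g x) = Y.act g (lin x)

instance : Category (TwistedCenter k G α) where
  Hom X Y := Hom X Y
  id X := ⟨LinearMap.id, fun _ _ => rfl, fun _ _ => rfl⟩
  comp φ ψ := ⟨ψ.lin ∘ₗ φ.lin,
    fun g x => by simp [φ.lin_pr, ψ.lin_pr], fun g x => by simp [φ.lin_act, ψ.lin_act]⟩

section

variable {X Y Z W X' Y' Z' : TwistedCenter k G α}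

theorem hom_ext {φ ψ : X ⟶ Y} (h : φ.lin = ψ.lin) : φ = ψ := Hom.ext h

@[simp] theorem id_lin : Hom.lin (𝟙 X) = LinearMap.id := rfl

@[simp] theorem comp_lin (φ : X ⟶ Y) (ψ : Y ⟶ Z) : (φ ≫ ψ).lin = ψ.lin ∘ₗ φ.lin := rfl

theorem lin_homog (φ : X ⟶ Y) {g : G} {x : X.carrier} (hx : X.pr g x = x) :
    Y.pr g (φ.lin x) = φ.lin x := by
  rw [← φ.lin_pr, hx]

theorem tensor_homog {g h : G} {x : X.carrier} {y : Y.carrier} (hx : X.pr g x = x)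
    (hy : Y.pr h y = y) : (tensorObj X Y).pr (g * h) (x ⊗ₜ y) = x ⊗ₜ y :=
  tensorPr_tmul hx hy

theorem pr_of_homog (φ : X.carrier →ₗ[k] Y.carrier)
    (h : ∀ (g : G) (x : X.carrier), X.pr g x = x → Y.pr g (φ x) = φ x) (g : G) (x : X.carrier) :
    φ (X.pr g x) = Y.pr g (φ x) := by
  suffices e : φ ∘ₗ X.pr g = Y.pr g ∘ₗ φ from
    congrArg (fun ψ : X.carrier →ₗ[k] Y.carrier => ψ x) e
  refine lin_ext fun a x hx => ?_
  simp only [LinearMap.comp_apply]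
  by_cases ha : g = a
  · subst ha
    rw [hx, h _ _ hx]
  · rw [pr_ne hx ha, pr_ne (h _ _ hx) ha, map_zero]

theorem pr_of_homog₂ (φ : X.carrier ⊗[k] Y.carrier →ₗ[k] Z.carrier)
    (h : ∀ (f g : G) (x : X.carrier) (y : Y.carrier), X.pr f x = x → Y.pr g y = y →
      Z.pr (f * g) (φ (x ⊗ₜ y)) = φ (x ⊗ₜ y)) (g : G) (t : X.carrier ⊗[k] Y.carrier) :
    φ (tensorPr X Y g t) = Z.pr g (φ t) := by
  suffices e : φ ∘ₗ tensorPr X Y g = Z.pr g ∘ₗ φ from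
    congrArg (fun ψ : X.carrier ⊗[k] Y.carrier →ₗ[k] Z.carrier => ψ t) e
  refine lin_ext₂ fun a b x y hx hy => ?_
  simp only [LinearMap.comp_apply]
  by_cases ha : g = a * b
  · subst ha
    rw [tensorPr_tmul hx hy, h _ _ _ _ hx hy]
  · rw [tensorPr_tmul_ne hx hy ha, pr_ne (h _ _ _ _ hx hy) ha, map_zero]

theorem act_of_homog₂ (φ : X.carrier ⊗[k] Y.carrier →ₗ[k] Z.carrier)
    (h : ∀ (f a b : G) (x : X.carrier) (y : Y.carrier), X.pr a x = x → Y.pr b y = y →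
      (α.tensorTwist f a b : k) • φ (X.act f x ⊗ₜ Y.act f y) = Z.act f (φ (x ⊗ₜ y)))
    (f : G) (t : X.carrier ⊗[k] Y.carrier) :
    φ (tensorAct X Y f t) = Z.act f (φ t) := by
  suffices e : φ ∘ₗ tensorAct X Y f = Z.act f ∘ₗ φ from
    congrArg (fun ψ : X.carrier ⊗[k] Y.carrier →ₗ[k] Z.carrier => ψ t) e
  refine lin_ext₂ fun a b x y hx hy => ?_
  simp only [LinearMap.comp_apply]
  rw [tensorAct_tmul f hx hy, map_smul, h f a b x y hx hy]

/-- A morphism with a linear inverse is an isomorphism. -/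
def isoOfLin (φ : X ⟶ Y) (ψ : Y.carrier →ₗ[k] X.carrier) (h₁ : ψ ∘ₗ φ.lin = LinearMap.id)
    (h₂ : φ.lin ∘ₗ ψ = LinearMap.id) : X ≅ Y where
  hom := φ
  inv :=
    { lin := ψ
      lin_pr := fun g y => by
        have e₁ : ∀ x, ψ (φ.lin x) = x := fun x => congrArg (fun θ => θ x) h₁
        have e₂ : ∀ x, φ.lin (ψ x) = x := fun x => congrArg (fun θ => θ x) h₂
        rw [← e₁ (X.pr g (ψ y)), φ.lin_pr, e₂]
      lin_act := fun g y => by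
        have e₁ : ∀ x, ψ (φ.lin x) = x := fun x => congrArg (fun θ => θ x) h₁
        have e₂ : ∀ x, φ.lin (ψ x) = x := fun x => congrArg (fun θ => θ x) h₂
        rw [← e₁ (X.act g (ψ y)), φ.lin_act, e₂] }
  hom_inv_id := hom_ext h₁
  inv_hom_id := hom_ext h₂

/-- The tensor product of morphisms. -/
noncomputable def tensorHom (φ : X ⟶ X') (ψ : Y ⟶ Y') : tensorObj X Y ⟶ tensorObj X' Y' where
  lin := TensorProduct.map φ.lin ψ.lin
  lin_pr := pr_of_homog₂ (Z := tensorObj X' Y') _ fun _ _ _ _ hx hy =>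
    tensor_homog (lin_homog φ hx) (lin_homog ψ hy)
  lin_act := act_of_homog₂ (Z := tensorObj X' Y') _ fun f a b x y hx hy => by
    rw [TensorProduct.map_tmul, TensorProduct.map_tmul, φ.lin_act, ψ.lin_act]
    exact (tensorAct_tmul f (lin_homog φ hx) (lin_homog ψ hy)).symm

variable (X Y Z W)

/-- The associativity isomorphism. -/
noncomputable def associator : tensorObj (tensorObj X Y) Z ≅ tensorObj X (tensorObj Y Z) :=
  isoOfLin
    { lin := assocLin X Y Z
      lin_pr := by
        intro g t
        suffices e : assocLin X Y Z ∘ₗ tensorPr (tensorObj X Y) Z g =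
            tensorPr X (tensorObj Y Z) g ∘ₗ assocLin X Y Z from
          congrArg (fun θ => θ t) e
        refine lin_ext₃ fun a b c x y z hx hy hz => ?_
        simp only [LinearMap.comp_apply]
        by_cases hg : g = a * b * c
        · rw [hg, tensorPr_tmul (tensor_homog hx hy) hz, assocLin_tmul hx hy hz, map_smul,
            mul_assoc, tensorPr_tmul hx (tensor_homog hy hz)]
        · rw [tensorPr_tmul_ne (tensor_homog hx hy) hz hg, assocLin_tmul hx hy hz, map_smul,
            tensorPr_tmul_ne hx (tensor_homog hy hz) (by rwa [← mul_assoc]), map_zero, smul_zero]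
      lin_act := by
        intro g t
        suffices e : assocLin X Y Z ∘ₗ tensorAct (tensorObj X Y) Z g =
            tensorAct X (tensorObj Y Z) g ∘ₗ assocLin X Y Z from
          congrArg (fun θ => θ t) e
        refine lin_ext₃ fun a b c x y z hx hy hz => ?_
        simp only [LinearMap.comp_apply]
        rw [tensorAct_tmul g (tensor_homog hx hy) hz, tensorAct_tmul g hx hy,
          assocLin_tmul hx hy hz, map_smul, map_smul, tensorAct_tmul g hx (tensor_homog hy hz),
          tensorAct_tmul g hy hz, ← TensorProduct.smul_tmul', map_smul,
          assocLin_tmul (act_homog g hx) (act_homog g hy) (act_homog g hz), TensorProduct.tmul_smul]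
        simp only [smul_smul]
        congr 1
        have key : ∀ A B C D E F : kˣ, A * (B * C) = D * E * F →
            B * (C * F⁻¹) = A⁻¹ * (D * E) := by
          intro A B C D E F h
          rw [eq_inv_mul_iff_mul_eq, ← mul_assoc B C, ← mul_assoc A, h, mul_inv_cancel_right]
        exact_mod_cast congrArg Units.val (key _ _ _ _ _ _ (α.tensorTwist_assoc g a b c)) }
    (assocInvLin X Y Z)
    (by
      refine lin_ext₃ fun a b c x y z hx hy hz => ?_
      simp only [LinearMap.comp_apply]
      rw [assocLin_tmul hx hy hz, map_smul, assocInvLin_tmul hx hy hz, smul_smul]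
      simp)
    (by
      refine lin_ext₃' fun a b c x y z hx hy hz => ?_
      simp only [LinearMap.comp_apply]
      rw [assocInvLin_tmul hx hy hz, map_smul, assocLin_tmul hx hy hz, smul_smul]
      simp)

theorem eq_or_zero_of_homog {g : G} {c : (unitObj α).carrier} (hc : (unitObj α).pr g c = c) :
    g = 1 ∨ c = 0 := by
  by_cases hg : g = 1
  · exact Or.inl hg
  · refine Or.inr ?_
    rw [← hc]
    simp [hg]

/-- The left unit isomorphism. -/
noncomputable def leftUnitor : tensorObj (unitObj α) X ≅ X :=
  isoOfLin
    { lin := (TensorProduct.lid k X.carrier).toLinearMap ∘ₗ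
        TensorProduct.map ULift.moduleEquiv.toLinearMap LinearMap.id
      lin_pr := pr_of_homog₂ (X := unitObj α) _ fun f g c x hc hx => by
        rcases eq_or_zero_of_homog hc with rfl | rfl
        · simp [hx]
        · simp
      lin_act := act_of_homog₂ (X := unitObj α) _ fun f a b c x hc hx => by
        rcases eq_or_zero_of_homog hc with rfl | rfl
        · simp
        · simp }
    (TensorProduct.map ULift.moduleEquiv.symm.toLinearMap LinearMap.id ∘ₗ
      (TensorProduct.lid k X.carrier).symm.toLinearMap)
    (by
      ext c x
      simp [TensorProduct.smul_tmul']) (by ext; simp)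

/-- The right unit isomorphism. -/
noncomputable def rightUnitor : tensorObj X (unitObj α) ≅ X :=
  isoOfLin
    { lin := (TensorProduct.rid k X.carrier).toLinearMap ∘ₗ
        TensorProduct.map LinearMap.id ULift.moduleEquiv.toLinearMap
      lin_pr := pr_of_homog₂ (Y := unitObj α) _ fun f g x c hx hc => by
        rcases eq_or_zero_of_homog hc with rfl | rfl
        · simp [hx]
        · simp
      lin_act := act_of_homog₂ (Y := unitObj α) _ fun f a b x c hx hc => by
        rcases eq_or_zero_of_homog hc with rfl | rfl
        · simp
        · simp }
    (TensorProduct.map LinearMap.id ULift.moduleEquiv.symm.toLinearMap ∘ₗ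
      (TensorProduct.rid k X.carrier).symm.toLinearMap)
    (by
      ext x c
      simp [← TensorProduct.tmul_smul]) (by ext; simp)

/-- The braiding isomorphism. -/
noncomputable def braidIso : tensorObj X Y ≅ tensorObj Y X :=
  isoOfLin
    { lin := braidLin X Y
      lin_pr := pr_of_homog₂ (Z := tensorObj Y X) _ fun f g x y hx hy => by
        rw [braidLin_tmul hx]
        have e : f * g = (f * g * f⁻¹) * f := by group
        rw [e]
        exact tensor_homog (act_homog f hy) hx
      lin_act := act_of_homog₂ (Z := tensorObj Y X) _ fun f a b x y hx hy => by
        rw [braidLin_tmul hx, braidLin_tmul (act_homog f hx)]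
        refine Eq.trans ?_ (tensorAct_tmul f (act_homog a hy) hx).symm
        have e1 := act_mul_homog (f * a * f⁻¹) f hy
        rw [show f * a * f⁻¹ * f = f * a by group, act_mul_homog f a hy] at e1
        have e2 : Y.act (f * a * f⁻¹) (Y.act f y) =
            (((α.actTwist (f * a * f⁻¹) f b)⁻¹ * α.actTwist f a b : kˣ) : k) •
              Y.act f (Y.act a y) := by
          rw [Units.val_mul, ← smul_smul, e1, smul_smul]
          simp
        rw [e2, ← TensorProduct.smul_tmul', smul_smul]
        congr 1
        have key : ∀ A B C D : kˣ, A * B = C * D → D * (A⁻¹ * C) = B := by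
          intro A B C D h
          rw [mul_comm, mul_assoc, ← h, inv_mul_cancel_left]
        exact_mod_cast congrArg Units.val (key _ _ _ _ (α.actTwist_braid f a b)) }
    (braidInvLin X Y)
    (by
      refine lin_ext₂ fun a b x y hx hy => ?_
      simp only [LinearMap.comp_apply]
      rw [braidLin_tmul hx, braidInvLin_tmul hx, actInv_act]
      rfl)
    (by
      refine lin_ext₂ fun a b y x hy hx => ?_
      simp only [LinearMap.comp_apply]
      rw [braidInvLin_tmul hx, braidLin_tmul hx, act_actInv]
      rfl)

end

end TwistedCenter

namespace TwistedCenter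

variable {k : Type u} [Field k] {G : Type v} [Group G] [Fintype G] {α : NormCocycle k G}

open CategoryTheory MonoidalCategory

noncomputable instance : MonoidalCategoryStruct (TwistedCenter k G α) where
  tensorObj := tensorObj
  whiskerLeft X _ _ φ := tensorHom (𝟙 X) φ
  whiskerRight φ Y := tensorHom φ (𝟙 Y)
  tensorHom := tensorHom
  tensorUnit := unitObj α
  associator := associator
  leftUnitor := leftUnitor
  rightUnitor := rightUnitor

section

variable {X Y Z W X' Y' Z' : TwistedCenter k G α}

theorem tensorHom_lin (φ : X ⟶ X') (ψ : Y ⟶ Y') :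
    (tensorHom φ ψ).lin = TensorProduct.map φ.lin ψ.lin := rfl

theorem associator_hom_lin : (associator X Y Z).hom.lin = assocLin X Y Z := rfl

theorem associator_inv_lin : (associator X Y Z).inv.lin = assocInvLin X Y Z := rfl

theorem leftUnitor_hom_lin (c : ULift.{v} k) (x : X.carrier) :
    (leftUnitor X).hom.lin (c ⊗ₜ x) = c.down • x := rfl

theorem rightUnitor_hom_lin (c : ULift.{v} k) (x : X.carrier) :
    (rightUnitor X).hom.lin (x ⊗ₜ c) = c.down • x := rfl

theorem braidIso_hom_lin : (braidIso X Y).hom.lin = braidLin X Y := rfl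

theorem pentagon_aux :
    tensorHom (associator W X Y).hom (𝟙 Z) ≫ (associator W (tensorObj X Y) Z).hom ≫
      tensorHom (𝟙 W) (associator X Y Z).hom =
    (associator (tensorObj W X) Y Z).hom ≫ (associator W X (tensorObj Y Z)).hom := by
  refine hom_ext ?_
  simp only [comp_lin, id_lin, tensorHom_lin, associator_hom_lin]
  refine TensorProduct.ext <| lin_ext₃ fun f g h w x y hw hx hy => lin_ext fun l z hz => ?_
  change (TensorProduct.map LinearMap.id (assocLin X Y Z))
      (assocLin W (tensorObj X Y) Z (assocLin W X Y ((w ⊗ₜ x) ⊗ₜ y) ⊗ₜ z)) =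
    assocLin W X (tensorObj Y Z) (assocLin (tensorObj W X) Y Z (((w ⊗ₜ x) ⊗ₜ y) ⊗ₜ z))
  rw [assocLin_tmul hw hx hy, ← TensorProduct.smul_tmul', map_smul, map_smul,
    assocLin_tmul hw (tensor_homog hx hy) hz, map_smul, TensorProduct.map_tmul,
    assocLin_tmul hx hy hz, assocLin_tmul (tensor_homog hw hx) hy hz, map_smul,
    assocLin_tmul hw hx (tensor_homog hy hz), TensorProduct.tmul_smul]
  simp only [smul_smul, LinearMap.id_apply]
  congr 1
  have key : ∀ A B C D E : kˣ, A * B * C = D * E → C⁻¹ * (B⁻¹ * A⁻¹) = D⁻¹ * E⁻¹ := by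
    intro A B C D E h
    rw [← mul_inv_rev, ← mul_inv_rev, h, mul_inv]
  exact_mod_cast congrArg Units.val (key _ _ _ _ _ (α.cocycle f g h l))

theorem hexagon_aux₁ :
    (associator X Y Z).hom ≫ (braidIso X (tensorObj Y Z)).hom ≫ (associator Y Z X).hom =
      tensorHom (braidIso X Y).hom (𝟙 Z) ≫ (associator Y X Z).hom ≫
        tensorHom (𝟙 Y) (braidIso X Z).hom := by
  refine hom_ext ?_
  simp only [comp_lin, id_lin, tensorHom_lin, associator_hom_lin, braidIso_hom_lin]
  refine lin_ext₃ fun f g h x y z hx hy hz => ?_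
  simp only [LinearMap.comp_apply, TensorProduct.map_tmul, LinearMap.id_apply]
  rw [assocLin_tmul hx hy hz, map_smul, map_smul, braidLin_tmul hx, braidLin_tmul hx,
    tensorAct_tmul f hy hz, ← TensorProduct.smul_tmul', map_smul,
    assocLin_tmul (act_homog f hy) (act_homog f hz) hx,
    assocLin_tmul (act_homog f hy) hx hz, map_smul, TensorProduct.map_tmul, braidLin_tmul hx]
  simp only [smul_smul, LinearMap.id_apply]
  congr 1
  rw [NormCocycle.tensorTwist]
  simp

theorem hexagon_aux₂ :
    (associator X Y Z).inv ≫ (braidIso (tensorObj X Y) Z).hom ≫ (associator Z X Y).inv =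
      tensorHom (𝟙 X) (braidIso Y Z).hom ≫ (associator X Z Y).inv ≫
        tensorHom (braidIso X Z).hom (𝟙 Y) := by
  refine hom_ext ?_
  simp only [comp_lin, id_lin, tensorHom_lin, associator_inv_lin, braidIso_hom_lin]
  refine lin_ext₃' fun f g h x y z hx hy hz => ?_
  simp only [LinearMap.comp_apply, TensorProduct.map_tmul, LinearMap.id_apply]
  have h1 : Z.pr (f * g * h * (f * g)⁻¹) (Z.act f (Z.act g z)) = Z.act f (Z.act g z) := by
    have := act_homog f (act_homog g hz)
    rwa [show f * (g * h * g⁻¹) * f⁻¹ = f * g * h * (f * g)⁻¹ by group] at this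
  rw [assocInvLin_tmul hx hy hz, map_smul, map_smul, braidLin_tmul (tensor_homog hx hy),
    act_mul_homog f g hz, ← TensorProduct.smul_tmul', map_smul, assocInvLin_tmul h1 hx hy,
    braidLin_tmul hy, assocInvLin_tmul hx (act_homog g hz) hy, map_smul, TensorProduct.map_tmul,
    braidLin_tmul hx]
  simp only [smul_smul, LinearMap.id_apply]
  congr 1
  rw [NormCocycle.actTwist]
  simp

end

noncomputable instance : MonoidalCategory (TwistedCenter k G α) :=
  MonoidalCategory.ofTensorHom
    (id_tensorHom_id := fun X Y => hom_ext (TensorProduct.map_id))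
    (id_tensorHom := fun _ _ _ _ => rfl)
    (tensorHom_id := fun _ _ => rfl)
    (tensorHom_comp_tensorHom := fun φ₁ φ₂ ψ₁ ψ₂ => hom_ext (TensorProduct.map_comp _ _ _ _).symm)
    (associator_naturality := fun {X₁ X₂ X₃ Y₁ Y₂ Y₃} φ₁ φ₂ φ₃ =>
      show tensorHom (tensorHom φ₁ φ₂) φ₃ ≫ (associator Y₁ Y₂ Y₃).hom =
        (associator X₁ X₂ X₃).hom ≫ tensorHom φ₁ (tensorHom φ₂ φ₃) from by
      refine hom_ext ?_
      simp only [comp_lin, tensorHom_lin, associator_hom_lin]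
      refine lin_ext₃ fun f g h x y z hx hy hz => ?_
      simp only [LinearMap.comp_apply, TensorProduct.map_tmul]
      rw [assocLin_tmul hx hy hz, map_smul, TensorProduct.map_tmul, TensorProduct.map_tmul,
        assocLin_tmul (lin_homog φ₁ hx) (lin_homog φ₂ hy) (lin_homog φ₃ hz)])
    (leftUnitor_naturality := fun {X Y} φ =>
      show tensorHom (𝟙 (unitObj α)) φ ≫ (leftUnitor Y).hom = (leftUnitor X).hom ≫ φ from by
      refine hom_ext (TensorProduct.ext' fun c x => ?_)
      change c.down • φ.lin x = φ.lin (c.down • x)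
      rw [map_smul])
    (rightUnitor_naturality := fun {X Y} φ =>
      show tensorHom φ (𝟙 (unitObj α)) ≫ (rightUnitor Y).hom = (rightUnitor X).hom ≫ φ from by
      refine hom_ext (TensorProduct.ext' fun x c => ?_)
      change c.down • φ.lin x = φ.lin (c.down • x)
      rw [map_smul])
    (pentagon := fun W X Y Z => pentagon_aux)
    (triangle := fun X Y =>
      show (associator X (unitObj α) Y).hom ≫ tensorHom (𝟙 X) (leftUnitor Y).hom =
        tensorHom (rightUnitor X).hom (𝟙 Y) from by
      refine hom_ext (lin_ext₃ fun f g h x c y hx hc hy => ?_)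
      change TensorProduct.map LinearMap.id (leftUnitor Y).hom.lin
        (assocLin X (unitObj α) Y ((x ⊗ₜ c) ⊗ₜ y)) = (c.down • x) ⊗ₜ y
      rw [assocLin_tmul hx hc hy, map_smul, TensorProduct.map_tmul, leftUnitor_hom_lin]
      rcases eq_or_zero_of_homog hc with rfl | rfl
      · simp [α.one_mid, TensorProduct.smul_tmul]
      · simp)

noncomputable instance : BraidedCategory (TwistedCenter k G α) where
  braiding := braidIso
  braiding_naturality_right X Y Z φ :=
    show tensorHom (𝟙 X) φ ≫ (braidIso X Z).hom = (braidIso X Y).hom ≫ tensorHom φ (𝟙 X) from by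
    refine hom_ext ?_
    simp only [comp_lin, id_lin, tensorHom_lin, braidIso_hom_lin]
    refine lin_ext₂ fun f g x y hx hy => ?_
    simp only [LinearMap.comp_apply, TensorProduct.map_tmul, LinearMap.id_apply]
    rw [braidLin_tmul hx, braidLin_tmul hx, TensorProduct.map_tmul, φ.lin_act]
    rfl
  braiding_naturality_left {X Y} φ Z :=
    show tensorHom φ (𝟙 Z) ≫ (braidIso Y Z).hom = (braidIso X Z).hom ≫ tensorHom (𝟙 Z) φ from by
    refine hom_ext ?_
    simp only [comp_lin, id_lin, tensorHom_lin, braidIso_hom_lin]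
    refine lin_ext₂ fun f g x z hx hz => ?_
    simp only [LinearMap.comp_apply, TensorProduct.map_tmul, LinearMap.id_apply]
    rw [braidLin_tmul hx, braidLin_tmul (lin_homog φ hx)]
    rfl
  hexagon_forward _ _ _ := hexagon_aux₁
  hexagon_reverse _ _ _ := hexagon_aux₂

section Preadditive

variable (X Y : TwistedCenter k G α)

instance : Zero (X ⟶ Y) := ⟨⟨0, by simp, by simp⟩⟩
instance : Add (X ⟶ Y) := ⟨fun φ ψ => ⟨φ.lin + ψ.lin, by simp [φ.lin_pr, ψ.lin_pr],
  by simp [φ.lin_act, ψ.lin_act]⟩⟩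
instance : Neg (X ⟶ Y) := ⟨fun φ => ⟨-φ.lin, by simp [φ.lin_pr], by simp [φ.lin_act]⟩⟩

instance : AddCommGroup (X ⟶ Y) where
  add_assoc _ _ _ := hom_ext (add_assoc _ _ _)
  zero_add _ := hom_ext (zero_add _)
  add_zero _ := hom_ext (add_zero _)
  add_comm _ _ := hom_ext (add_comm _ _)
  neg_add_cancel _ := hom_ext (neg_add_cancel _)
  nsmul := nsmulRec
  zsmul := zsmulRec

instance : Preadditive (TwistedCenter k G α) where
  add_comp _ _ _ _ _ _ := hom_ext (LinearMap.comp_add _ _ _)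
  comp_add _ _ _ _ _ _ := hom_ext (LinearMap.add_comp _ _ _)

@[simp] theorem add_lin (φ ψ : X ⟶ Y) : (φ + ψ).lin = φ.lin + ψ.lin := rfl

@[simp] theorem zero_lin : Hom.lin (0 : X ⟶ Y) = 0 := rfl

end Preadditive

end TwistedCenter

section Lagrangian

open CategoryTheory MonoidalCategory

universe w₁ w₂

variable {C : Type w₂} [Category.{w₁} C] [MonoidalCategory C]

/-- A (unital) right module over an algebra `A` in a monoidal category. -/
structure RightModule (A : C) [MonObj A] where
  carrier : C
  act : carrier ⊗ A ⟶ carrier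
  act_act : act ▷ A ≫ act = (α_ carrier A A).hom ≫ carrier ◁ MonObj.mul ≫ act
  act_one : carrier ◁ MonObj.one ≫ act = (ρ_ carrier).hom

namespace RightModule

variable {A : C} [MonObj A]

/-- Homomorphisms of right `A`-modules. -/
@[ext]
structure Hom (M N : RightModule A) where
  hom : M.carrier ⟶ N.carrier
  comm : M.act ≫ hom = hom ▷ A ≫ N.act

instance : Category (RightModule A) where
  Hom M N := Hom M N
  id M := ⟨𝟙 M.carrier, by simp⟩
  comp φ ψ := ⟨φ.hom ≫ ψ.hom, by
    rw [← Category.assoc, φ.comm, Category.assoc, ψ.comm, comp_whiskerRight, Category.assoc]⟩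
  id_comp φ := Hom.ext (Category.id_comp φ.hom)
  comp_id φ := Hom.ext (Category.comp_id φ.hom)
  assoc φ ψ θ := Hom.ext (Category.assoc φ.hom ψ.hom θ.hom)

/-- The regular right module `A`. -/
@[simps]
def regular (A : C) [MonObj A] : RightModule A where
  carrier := A
  act := MonObj.mul
  act_act := MonObj.mul_assoc A
  act_one := MonObj.mul_one A

/-- `M` is local if the action is unchanged by precomposition with the double braiding
`M ⊗ A ⟶ A ⊗ M ⟶ M ⊗ A`. -/
def IsLocal [BraidedCategory C] (M : RightModule A) : Prop :=
  (β_ M.carrier A).hom ≫ (β_ A M.carrier).hom ≫ M.act = M.act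

/-- `M` is a (finite, possibly empty) direct sum of copies of the regular module `A`. -/
def IsSumOfRegular [Preadditive C] (M : RightModule A) : Prop :=
  ∃ (n : ℕ) (ι : Fin n → (regular A ⟶ M)) (π : Fin n → (M ⟶ regular A)),
    (∀ i, (ι i ≫ π i).hom = 𝟙 A) ∧ (∀ i j, i ≠ j → (ι i ≫ π j).hom = 0) ∧
      ∑ i, (π i ≫ ι i).hom = 𝟙 M.carrier

end RightModule

/-- A commutative algebra in an additive braided category is Lagrangian if every local right
module over it is a direct sum of copies of the regular module. -/
def IsLagrangian [BraidedCategory C] [Preadditive C] (A : C) [MonObj A] [IsCommMonObj A] : Prop :=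
  ∀ M : RightModule A, M.IsLocal → M.IsSumOfRegular

end Lagrangian

/-- The data `(γ, ε)` of an etale algebra `k[F, γ, ε]` in `𝒵(H, α)`, for `F ⊴ H`.  Here
`MulAut.conjNormal h f = h f h⁻¹` as an element of `F`. -/
structure EtaleDatum {k : Type*} [Field k] {H : Type*} [Group H] (α : NormCocycle k H)
    (F : Subgroup H) [F.Normal] where
  γ : F → F → kˣ
  ε : H → F → kˣ
  d_γ : ∀ f g h : F,
    γ g h * (γ (f * g) h)⁻¹ * γ f (g * h) * (γ f g)⁻¹ = α.toFun f g h
  ε_mul : ∀ (g h : H) (f : F),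
    ε (g * h) f = α.actTwist g h f * ε g (MulAut.conjNormal h f) * ε h f
  ε_γ : ∀ (h : H) (f g : F),
    γ f g * ε h (f * g) = α.tensorTwist h f g * ε h f * ε h g *
      γ (MulAut.conjNormal h f) (MulAut.conjNormal h g)
  γ_comm : ∀ f g : F, γ f g = ε f g * γ (f * g * f⁻¹) f

namespace EtaleDatum

variable {k : Type u} [Field k] {H : Type v} [Group H] {α : NormCocycle k H}
  {F : Subgroup H} [F.Normal] (D : EtaleDatum α F)

open CategoryTheory MonoidalCategory TwistedCenter

theorem γ_one_left (f : F) : D.γ 1 f = D.γ 1 1 := by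
  have := D.d_γ 1 1 f
  simpa [α.one_left, mul_inv_eq_one] using this

theorem γ_one_right (f : F) : D.γ f 1 = D.γ 1 1 := by
  have := D.d_γ f 1 1
  simp [α.one_right, mul_inv_eq_one] at this
  exact this.symm

theorem ε_one (f : F) : D.ε 1 f = 1 := by
  have := D.ε_mul 1 1 f
  simpa using this

theorem ε_unit (h : H) : D.ε h 1 = 1 := by
  have := D.ε_γ h 1 1
  simp only [mul_one, map_one, OneMemClass.coe_one, NormCocycle.tensorTwist_one_left, one_mul] at this
  rw [mul_comm, mul_left_inj] at this
  simpa using this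

/-- The projection of `k[F]` onto the degree `g` component: `e_f ↦ e_f` if `f = g`, else `0`. -/
noncomputable def pr (F : Subgroup H) (g : H) : Module.End k (F →₀ k) :=
  open Classical in
  Finsupp.linearCombination k fun f : F => if (f : H) = g then Finsupp.single f 1 else 0

/-- The action `h.e_f = ε_h(f) e_{hfh⁻¹}`. -/
noncomputable def act (h : H) : Module.End k (F →₀ k) :=
  Finsupp.linearCombination k fun f : F =>
    (D.ε h f : k) • Finsupp.single (MulAut.conjNormal h f) (1 : k)

/-- The multiplication `e_f e_g = γ(f, g) e_{fg}`. -/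
noncomputable def mulLin : (F →₀ k) ⊗[k] (F →₀ k) →ₗ[k] (F →₀ k) :=
  TensorProduct.lift <| Finsupp.linearCombination k fun f : F =>
    Finsupp.linearCombination k fun g : F => (D.γ f g : k) • Finsupp.single (f * g) (1 : k)

/-- The unit `1 ↦ γ(1, 1)⁻¹ e_1`. -/
noncomputable def oneLin : ULift.{v} k →ₗ[k] (F →₀ k) :=
  LinearMap.toSpanSingleton k (F →₀ k) ((((D.γ 1 1)⁻¹ : kˣ) : k) • Finsupp.single 1 (1 : k)) ∘ₗ
    ULift.moduleEquiv.toLinearMap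

theorem pr_self (f : F) :
    pr F (f : H) (Finsupp.single f (1 : k)) = Finsupp.single f (1 : k) := by
  simp [pr]

theorem pr_ne {f : F} {g : H} (h : (f : H) ≠ g) :
    pr F g (Finsupp.single f (1 : k)) = 0 := by
  simp [pr, h]

theorem act_single (h : H) (f : F) : D.act h (Finsupp.single f (1 : k)) =
    (D.ε h f : k) • Finsupp.single (MulAut.conjNormal h f) (1 : k) := by
  simp [act]

theorem mulLin_single (f g : F) :
    D.mulLin (Finsupp.single f (1 : k) ⊗ₜ Finsupp.single g (1 : k)) =
      (D.γ f g : k) • Finsupp.single (f * g) (1 : k) := by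
  simp [mulLin]

theorem oneLin_up (c : ULift.{v} k) :
    D.oneLin c = c.down • (((D.γ 1 1)⁻¹ : kˣ) : k) • Finsupp.single 1 (1 : k) := rfl

theorem ext_single {M : Type*} [AddCommGroup M] [Module k M] {φ ψ : (F →₀ k) →ₗ[k] M}
    (h : ∀ f : F, φ (Finsupp.single f 1) = ψ (Finsupp.single f 1)) : φ = ψ :=
  Finsupp.lhom_ext' fun f => LinearMap.ext_ring (h f)

variable [Fintype H]

/-- The object `k[F, γ, ε] = ⨁_{f ∈ F} k e_f` of `𝒵(H, α)`. -/
noncomputable abbrev obj : TwistedCenter k H α where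
  carrier := F →₀ k
  pr := pr F
  pr_complete := by
    classical
    refine ⟨⟨fun g => ?_, fun g h hg => ?_⟩, ?_⟩
    · refine ext_single fun f => ?_
      rw [Module.End.mul_apply]
      by_cases hf : (f : H) = g
      · subst hf; simp only [pr_self]
      · simp only [pr_ne hf, map_zero]
    · refine ext_single fun f => ?_
      change pr F g (pr F h _) = 0
      by_cases hf : (f : H) = h
      · subst hf; rw [pr_self, pr_ne (Ne.symm hg)]
      · rw [pr_ne hf, map_zero]
    · refine ext_single fun f => ?_
      rw [LinearMap.sum_apply, Finset.sum_eq_single (f : H)]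
      · rw [pr_self]; rfl
      · intro b _ hb
        exact pr_ne (Ne.symm hb)
      · simp
  act := D.act
  act_pr := by
    intro h g v
    suffices e : D.act h ∘ₗ pr F g = pr F (h * g * h⁻¹) ∘ₗ D.act h from
      congrArg (fun θ : Module.End k (F →₀ k) => θ v) e
    refine ext_single fun f => ?_
    simp only [LinearMap.comp_apply, act_single, map_smul]
    by_cases hf : (f : H) = g
    · subst hf
      rw [pr_self, act_single, ← MulAut.conjNormal_apply, pr_self]
    · rw [pr_ne hf, pr_ne, map_zero, smul_zero]
      rw [MulAut.conjNormal_apply]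
      intro e
      exact hf (mul_left_cancel (mul_right_cancel e))
  act_one := by
    refine ext_single fun f => ?_
    rw [act_single, ε_one]
    simp
  act_mul := by
    intro g h l v
    suffices e : D.act (g * h) ∘ₗ pr F l =
        (α.actTwist g h l : k) • (D.act g ∘ₗ D.act h ∘ₗ pr F l) from
      congrArg (fun θ : Module.End k (F →₀ k) => θ v) e
    refine ext_single fun f => ?_
    simp only [LinearMap.comp_apply, LinearMap.smul_apply]
    by_cases hf : (f : H) = l
    · subst hf
      rw [pr_self, act_single, act_single, map_smul, act_single, D.ε_mul, map_mul]
      simp only [smul_smul, MulAut.mul_apply]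
      congr 1
      push_cast
      ring
    · rw [pr_ne hf]; simp

theorem ext_single₂ {M : Type*} [AddCommGroup M] [Module k M]
    {φ ψ : (F →₀ k) ⊗[k] (F →₀ k) →ₗ[k] M}
    (h : ∀ f g : F, φ (Finsupp.single f 1 ⊗ₜ Finsupp.single g 1) =
      ψ (Finsupp.single f 1 ⊗ₜ Finsupp.single g 1)) : φ = ψ :=
  TensorProduct.ext <| ext_single fun f => ext_single fun g => h f g

/-- The algebra `k[F, γ, ε]` in `𝒵(H, α)`. -/
noncomputable instance : MonObj D.obj where
  one :=
    { lin := D.oneLin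
      lin_pr := pr_of_homog (X := unitObj α) (Y := D.obj) _ fun g c hc => by
        rcases eq_or_zero_of_homog hc with rfl | rfl
        · rw [oneLin_up, map_smul, map_smul]
          congr 2
          exact pr_self 1
        · simp
      lin_act := by
        intro h c
        change D.oneLin c = D.act h (D.oneLin c)
        rw [oneLin_up, map_smul, map_smul, act_single, ε_unit]
        simp }
  mul :=
    { lin := D.mulLin
      lin_pr := by
        intro h t
        suffices e : D.mulLin ∘ₗ tensorPr D.obj D.obj h = pr F h ∘ₗ D.mulLin from
          congrArg (fun θ => θ t) e
        refine ext_single₂ fun f g => ?_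
        have hf : D.obj.pr f (Finsupp.single f (1 : k)) = Finsupp.single f (1 : k) := pr_self f
        have hg : D.obj.pr g (Finsupp.single g (1 : k)) = Finsupp.single g (1 : k) := pr_self g
        simp only [LinearMap.comp_apply, mulLin_single, map_smul]
        by_cases hh : h = (f : H) * g
        · subst hh
          rw [tensorPr_tmul hf hg, mulLin_single, ← Subgroup.coe_mul, pr_self]
        · rw [tensorPr_tmul_ne hf hg hh, pr_ne, map_zero, smul_zero]
          exact fun e => hh e.symm
      lin_act := by
        intro h t
        suffices e : D.mulLin ∘ₗ tensorAct D.obj D.obj h = D.act h ∘ₗ D.mulLin from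
          congrArg (fun θ => θ t) e
        refine ext_single₂ fun f g => ?_
        have hf : D.obj.pr f (Finsupp.single f (1 : k)) = Finsupp.single f (1 : k) := pr_self f
        have hg : D.obj.pr g (Finsupp.single g (1 : k)) = Finsupp.single g (1 : k) := pr_self g
        simp only [LinearMap.comp_apply]
        rw [tensorAct_tmul h hf hg, mulLin_single, map_smul, map_smul, act_single, act_single,
          act_single, TensorProduct.smul_tmul_smul, map_smul, mulLin_single, map_mul]
        simp only [smul_smul]
        congr 1
        have := congrArg Units.val (D.ε_γ h f g)
        push_cast at this
        rw [this]
        ring }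
  one_mul := by
    refine hom_ext (TensorProduct.ext' fun c x => ?_)
    change D.mulLin (D.oneLin c ⊗ₜ x) = c.down • x
    suffices e : D.mulLin ∘ₗ TensorProduct.mk k _ _ (D.oneLin c) = c.down • LinearMap.id from
      congrArg (fun θ : Module.End k (F →₀ k) => θ x) e
    refine ext_single fun f => ?_
    change D.mulLin (D.oneLin c ⊗ₜ _) = c.down • _
    rw [oneLin_up, ← TensorProduct.smul_tmul', ← TensorProduct.smul_tmul', map_smul, map_smul,
      mulLin_single, D.γ_one_left f, one_mul, smul_smul (((D.γ 1 1)⁻¹ : kˣ) : k), Units.inv_mul,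
      one_smul]
    rfl
  mul_one := by
    refine hom_ext (TensorProduct.ext' fun x c => ?_)
    change D.mulLin (x ⊗ₜ D.oneLin c) = c.down • x
    suffices e : D.mulLin ∘ₗ (TensorProduct.mk k _ _).flip (D.oneLin c) =
        c.down • LinearMap.id from
      congrArg (fun θ : Module.End k (F →₀ k) => θ x) e
    refine ext_single fun f => ?_
    change D.mulLin (_ ⊗ₜ D.oneLin c) = c.down • _
    rw [oneLin_up, TensorProduct.tmul_smul, TensorProduct.tmul_smul, map_smul, map_smul,
      mulLin_single, D.γ_one_right f, mul_one, smul_smul (((D.γ 1 1)⁻¹ : kˣ) : k), Units.inv_mul,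
      one_smul]
    rfl
  mul_assoc := by
    refine hom_ext (TensorProduct.ext <| ext_single₂ fun f g => ext_single fun h => ?_)
    change D.mulLin (D.mulLin (Finsupp.single f 1 ⊗ₜ Finsupp.single g 1) ⊗ₜ Finsupp.single h 1) =
      D.mulLin (TensorProduct.map LinearMap.id D.mulLin (assocLin D.obj D.obj D.obj
        ((Finsupp.single f 1 ⊗ₜ Finsupp.single g 1) ⊗ₜ Finsupp.single h 1)))
    have hf : D.obj.pr f (Finsupp.single f (1 : k)) = Finsupp.single f (1 : k) := pr_self f
    have hg : D.obj.pr g (Finsupp.single g (1 : k)) = Finsupp.single g (1 : k) := pr_self g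
    have hh : D.obj.pr h (Finsupp.single h (1 : k)) = Finsupp.single h (1 : k) := pr_self h
    rw [assocLin_tmul hf hg hh, map_smul, TensorProduct.map_tmul, mulLin_single, mulLin_single,
      ← TensorProduct.smul_tmul', TensorProduct.tmul_smul, map_smul, map_smul, map_smul,
      LinearMap.id_apply, mulLin_single, mulLin_single, mul_assoc]
    simp only [smul_smul]
    congr 1
    have key : ∀ A B C E X : kˣ, A * B⁻¹ * C * E⁻¹ = X → E * B = X⁻¹ * (A * C) := by
      rintro A B C E X rfl
      rw [eq_inv_mul_iff_mul_eq]
      calc A * B⁻¹ * C * E⁻¹ * (E * B) = A * C * (B⁻¹ * B) * (E⁻¹ * E) := by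
            simp only [mul_comm, mul_left_comm, mul_assoc]
        _ = A * C := by simp
    have := congrArg Units.val (key _ _ _ _ _ (D.d_γ f g h))
    push_cast at this
    rw [this]
    push_cast
    ring

/-- The algebra `k[F, γ, ε]` is commutative. -/
instance : IsCommMonObj D.obj where
  mul_comm := by
    refine hom_ext (ext_single₂ fun f g => ?_)
    have hf : D.obj.pr f (Finsupp.single f (1 : k)) = Finsupp.single f (1 : k) := pr_self f
    change D.mulLin (braidLin D.obj D.obj _) = D.mulLin _
    rw [braidLin_tmul hf]
    change D.mulLin (D.act f _ ⊗ₜ _) = _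
    rw [act_single, ← TensorProduct.smul_tmul', map_smul, mulLin_single, mulLin_single,
      D.γ_comm f g]
    have : MulAut.conjNormal (f : H) g = f * g * f⁻¹ := by
      ext; simp
    rw [this, smul_smul, inv_mul_cancel_right]
    push_cast
    rfl

end EtaleDatum

/-! Write `A = k[F, γ, ε]`. Its component of degree `1` is the line spanned by `e_1`, and all of `H`
fixes that line pointwise because `ε_h(1) = 1`. Hence `H` acts trivially on the degree `1` component
of any sum of copies of `A`. A local module, by contrast, is only forced to have trivial action of
`F` there. The theorem compares these two facts.

If `A` is Lagrangian, take the permutation representation `X = k[H/F]`, placed in degree `1`. Since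
`F` is normal it acts trivially on `X`, so `X` is transparent to `A`, and commutativity of `A` makes
the free module `X ⊗ A` local (`free_isLocal`). As a sum of copies of `A`, it has trivial `H`-action
in degree `1` (`act_eq_of_isSumOfRegular`). Looking at `x ⊗ e_1` then shows that `H` acts trivially
on `X`, so every `h` fixes the coset `F`, that is, `F = H`.

Conversely, let `F = H` and let `M` be local. Locality gives `(f.m) e_f = m e_f` for `m` of degree
`1`, and `e_f` is invertible up to a scalar, so `H` fixes `M_1` pointwise (`act_eq_of_isLocal`).
Multiplication by `e_f` identifies `M_1` with `M_f` for every `f ∈ H`. Therefore a basis of `M_1` is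
a basis of `M` over `A` (`sumLin_bijective`), and each basis vector `b` gives a module morphism `a ↦
b a` from `A` to `M`. -/

namespace RightModule

open CategoryTheory MonoidalCategory

/-- The free right module `V ⊗ A`. -/
def free {C : Type*} [Category C] [MonoidalCategory C] (A : C) [MonObj A] (V : C) :
    RightModule A where
  carrier := V ⊗ A
  act := (α_ V A A).hom ≫ V ◁ MonObj.mul
  act_act := by
    simp only [comp_whiskerRight, whisker_assoc, Category.assoc, Iso.inv_hom_id_assoc,
      tensor_whiskerLeft]
    -- With `V` pulled out of every whiskering, the content is associativity of `A` under `V ◁ -`;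
    -- only coherence of associators remains.
    rw [← MonoidalCategory.whiskerLeft_comp, MonObj.mul_assoc]
    simp
  act_one := by
    simp only [tensor_whiskerLeft, Category.assoc, Iso.inv_hom_id_assoc,
      ← MonoidalCategory.whiskerLeft_comp, MonObj.mul_one, rightUnitor_tensor_hom]

end RightModule

theorem TwistedCenter.sum_lin {k : Type u} [Field k] {G : Type v} [Group G] [Fintype G]
    {α : NormCocycle k G} {X Y : TwistedCenter k G α} {σ : Type*} (s : Finset σ)
    (φ : σ → (X ⟶ Y)) : Hom.lin (∑ i ∈ s, φ i : X ⟶ Y) = ∑ i ∈ s, (φ i).lin := by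
  let L : (X ⟶ Y) →+ (X.carrier →ₗ[k] Y.carrier) :=
    { toFun := fun φ => φ.lin, map_zero' := rfl, map_add' := fun _ _ => rfl }
  exact map_sum L φ s

namespace EtaleDatum

open CategoryTheory MonoidalCategory TwistedCenter

/-! ### Necessity: a Lagrangian `k[F, γ, ε]` has `F = H`. -/

section

variable {k : Type u} [Field k] {H : Type v} [Group H] [Fintype H]

/-- A representation of `H`, as an object of `𝒵(H, α)` concentrated in degree `1`. -/
noncomputable def repObj (α : NormCocycle k H) {V : Type (max u v)} [AddCommGroup V] [Module k V]
    [Module.Finite k V] (ρ : Representation k H V) : TwistedCenter k H α where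
  carrier := V
  pr := open Classical in fun g => if g = 1 then 1 else 0
  pr_complete := by
    classical
    refine ⟨⟨fun f => ?_, fun f f' hf => ?_⟩, ?_⟩
    · show _ * _ = _
      split_ifs <;> simp
    · show _ * _ = _
      split_ifs with h1 h2
      · exact absurd (h1.trans h2.symm) hf
      all_goals simp
    · simp
  act := ρ
  act_pr := by
    intro f g v
    by_cases hg : g = 1 <;> simp [hg]
  act_one := map_one ρ
  act_mul := by
    intro f g h v
    -- The twist `α(f, g | 1)` is trivial, so an honest representation is allowed in degree `1`; in
    -- other degrees the projection vanishes.
    by_cases hh : h = 1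
    · subst hh; simp
    · simp [hh]

variable {α : NormCocycle k H}

theorem repObj_pr_one {V : Type (max u v)} [AddCommGroup V] [Module k V]
    [Module.Finite k V] (ρ : Representation k H V) : (repObj α ρ).pr 1 = 1 := by
  classical
  exact if_pos rfl

variable {F : Subgroup H} [F.Normal] (D : EtaleDatum α F)

theorem obj_pr_single (f : F) :
    D.obj.pr f (Finsupp.single f (1 : k)) = Finsupp.single f (1 : k) := pr_self f

/-- Commutativity on elements; applied twice, it makes the multiplication blind to the double
braiding. -/
theorem mulLin_braidLin (t : (F →₀ k) ⊗[k] (F →₀ k)) :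
    D.mulLin (braidLin D.obj D.obj t) = D.mulLin t :=
  LinearMap.congr_fun (congrArg TwistedCenter.Hom.lin (IsCommMonObj.mul_comm D.obj)) t

/-- The braiding depends on the degree of the first factor and its action on the second. Degree `1`
and trivial `F`-action therefore reduce both braidings between `X` and `A` to plain swaps. What is
left is the double braiding of `A` with itself, which commutativity absorbs. -/
theorem free_isLocal {X : TwistedCenter k H α} (hX : X.pr 1 = 1) (hF : ∀ f : F, X.act f = 1) :
    (RightModule.free D.obj X).IsLocal := by
  refine hom_ext (TensorProduct.ext (TensorProduct.ext (LinearMap.ext fun x =>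
    ext_single fun g => ext_single fun f => ?_)))
  have hx : X.pr 1 x = x := LinearMap.congr_fun hX x
  have hf := D.obj_pr_single f
  have hg := D.obj_pr_single g
  change TensorProduct.map LinearMap.id D.mulLin (assocLin X D.obj D.obj
    (braidLin D.obj (TwistedCenter.tensorObj X D.obj)
      (braidLin (TwistedCenter.tensorObj X D.obj) D.obj
        ((x ⊗ₜ Finsupp.single g 1) ⊗ₜ Finsupp.single f 1)))) =
    TensorProduct.map LinearMap.id D.mulLin (assocLin X D.obj D.obj
      ((x ⊗ₜ Finsupp.single g 1) ⊗ₜ Finsupp.single f 1))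
  -- The first braiding replaces `e_f` by `g.e_f`, of degree `gfg⁻¹`; the second lets `gfg⁻¹` act on
  -- `x ⊗ e_g`. As `gfg⁻¹ ∈ F`, the vector `x` does not move.
  have hg' := act_homog (X := D.obj) ((g : H) * f * (g : H)⁻¹) hg
  have hf' := act_homog (X := D.obj) (g : H) hf
  have e : X.act ((g : H) * f * (g : H)⁻¹) x = x := LinearMap.congr_fun (hF (g * f * g⁻¹)) x
  rw [braidLin_tmul (tensor_homog hx hg), one_mul, braidLin_tmul hf', tensorAct_tmul _ hx hg, e,
    NormCocycle.tensorTwist_one_left, Units.val_one, one_smul, assocLin_tmul hx hg' hf',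
    assocLin_tmul hx hg hf, α.one_left, α.one_left, inv_one, Units.val_one, one_smul, one_smul,
    TensorProduct.map_tmul, TensorProduct.map_tmul]
  congr 1
  -- Only the double braiding of `e_g ⊗ e_f` is left.
  have := (D.mulLin_braidLin (braidLin D.obj D.obj _)).trans
    (D.mulLin_braidLin (Finsupp.single g 1 ⊗ₜ Finsupp.single f 1))
  rw [braidLin_tmul hg, braidLin_tmul hf'] at this
  exact this

/-- The degree `1` component is the line through `e_1`, which conjugation preserves and on which
`ε_h(1) = 1`. This holds for all `h ∈ H`, not only for `h ∈ F`. -/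
theorem act_eq_of_pr_one (h : H) {a : F →₀ k} (ha : D.obj.pr 1 a = a) : D.act h a = a := by
  suffices e : D.act h ∘ₗ pr F 1 = pr F 1 by
    have := LinearMap.congr_fun e a
    change D.act h (D.obj.pr 1 a) = D.obj.pr 1 a at this
    rwa [ha] at this
  refine ext_single fun f => ?_
  rw [LinearMap.comp_apply]
  by_cases hf : (f : H) = 1
  · obtain rfl : f = 1 := Subtype.ext hf
    have := pr_self (k := k) (1 : F)
    rw [OneMemClass.coe_one] at this
    rw [this, act_single, ε_unit, map_one, Units.val_one, one_smul]
  · rw [pr_ne hf, map_zero]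

/-- The components of `m` in the summands have degree `1` in `A`, hence are fixed; of the direct sum
only the identity `∑ π_i ≫ ι_i = 𝟙` is needed. -/
theorem act_eq_of_isSumOfRegular {M : RightModule D.obj} (hM : M.IsSumOfRegular) (h : H)
    {m : M.carrier.carrier} (hm : M.carrier.pr 1 m = m) : M.carrier.act h m = m := by
  obtain ⟨n, ι, π, -, -, hsum⟩ := hM
  have key : ∀ x : M.carrier.carrier, ∑ i, (ι i).hom.lin ((π i).hom.lin x) = x := by
    intro x
    have := LinearMap.congr_fun (congrArg TwistedCenter.Hom.lin hsum) x
    rw [sum_lin, LinearMap.sum_apply] at this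
    exact this
  conv_lhs => rw [← key m]
  rw [map_sum]
  conv_rhs => rw [← key m]
  refine Finset.sum_congr rfl fun i _ => ?_
  rw [← (ι i).hom.lin_act]
  congr 1
  exact D.act_eq_of_pr_one h (lin_homog (π i).hom hm)

/-- The map `x ↦ x ⊗ e_1` embeds `X_1` equivariantly in the degree `1` part of `X ⊗ A`. -/
theorem act_eq_of_free_isSumOfRegular {X : TwistedCenter k H α}
    (hX : (RightModule.free D.obj X).IsSumOfRegular) (h : H) {x : X.carrier} (hx : X.pr 1 x = x) :
    X.act h x = x := by
  have h1 := D.obj_pr_single 1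
  have hm : (TwistedCenter.tensorObj X D.obj).pr 1 (x ⊗ₜ Finsupp.single (1 : F) (1 : k)) =
      x ⊗ₜ Finsupp.single (1 : F) (1 : k) := by
    have := tensor_homog hx h1
    rwa [OneMemClass.coe_one, one_mul] at this
  have key := D.act_eq_of_isSumOfRegular hX h hm
  change tensorAct X D.obj h _ = _ at key
  rw [tensorAct_tmul h hx h1, NormCocycle.tensorTwist_one_left, Units.val_one, one_smul] at key
  change X.act h x ⊗ₜ[k] D.act h _ = _ at key
  rw [act_single, ε_unit, map_one, Units.val_one, one_smul] at key
  -- Reading off the coefficient of `e_1` recovers `x` from `x ⊗ e_1`.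
  have key' := congrArg (TensorProduct.rid k _ ∘ TensorProduct.map (LinearMap.id (R := k))
    (Finsupp.lapply (R := k) (1 : F))) key
  simpa only [Function.comp_apply, TensorProduct.map_tmul, Finsupp.lapply_apply,
    Finsupp.single_eq_same, LinearMap.id_apply, TensorProduct.rid_tmul, one_smul] using key'

/-- The test object is `k[H/F]`: normality puts `F` in the kernel of the representation, while the
stabiliser of the trivial coset is no larger than `F`. -/
theorem eq_top_of_isLagrangian (hL : IsLagrangian D.obj) : F = ⊤ := by
  let ρ : Representation k H ((H ⧸ F) →₀ k) :=
    { toFun := fun h => Finsupp.lmapDomain k k (h • ·)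
      map_one' := Finsupp.lhom_ext' fun x => LinearMap.ext_ring (by simp)
      map_mul' := fun g h => Finsupp.lhom_ext' fun x => LinearMap.ext_ring (by
        simp [mul_smul]) }
  have hsingle : ∀ h x, ρ h (Finsupp.single x 1) = Finsupp.single (h • x) 1 := fun h x =>
    Finsupp.mapDomain_single
  have hρ : ∀ f : F, ρ f = 1 := by
    intro f
    refine Finsupp.lhom_ext' fun x => LinearMap.ext_ring ?_
    change ρ f (Finsupp.single x 1) = Finsupp.single x 1
    rw [hsingle]
    congr 1
    obtain ⟨x, rfl⟩ := QuotientGroup.mk_surjective x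
    -- This element is `x⁻¹ f⁻¹ x`, so normality gives `f x F = x F`.
    have hx : ((f : H) * x)⁻¹ * x ∈ F := by
      simpa [mul_assoc] using Subgroup.Normal.conj_mem inferInstance _ (F.inv_mem f.2) x⁻¹
    exact QuotientGroup.eq.2 hx
  have hsum := hL _ (D.free_isLocal (X := repObj α ρ) (repObj_pr_one ρ) hρ)
  refine eq_top_iff.2 fun h _ => ?_
  suffices e : ρ h (Finsupp.single ((1 : H) : H ⧸ F) 1) = Finsupp.single ((1 : H) : H ⧸ F) 1 by
    rw [hsingle] at e
    have e' := QuotientGroup.eq.1 ((Finsupp.single_left_inj (one_ne_zero (α := k))).1 e)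
    simpa using e'
  exact D.act_eq_of_free_isSumOfRegular hsum h (LinearMap.congr_fun (repObj_pr_one ρ) _)

end

/-! ### Arithmetic of right modules: multiplication by `e_f` and the effect of locality. -/

section

variable {k : Type u} [Field k] {H : Type v} [Group H] [Fintype H] {α : NormCocycle k H}
  {F : Subgroup H} [F.Normal] {D : EtaleDatum α F} (M : RightModule D.obj)

/-- The action `m ↦ a ↦ m a` of a right module. -/
noncomputable def rmul : M.carrier.carrier →ₗ[k] (F →₀ k) →ₗ[k] M.carrier.carrier :=
  TensorProduct.curry M.act.lin

theorem rmul_homog {g h : H} {m : M.carrier.carrier} {a : F →₀ k} (hm : M.carrier.pr g m = m)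
    (ha : D.obj.pr h a = a) : M.carrier.pr (g * h) (rmul M m a) = rmul M m a :=
  lin_homog M.act (tensor_homog (Y := D.obj) hm ha)

/-- No scalar appears because `α(h | 1, f) = 1`. -/
theorem act_rmul_of_pr_one (h : H) {m : M.carrier.carrier} (hm : M.carrier.pr 1 m = m)
    (a : F →₀ k) :
    M.carrier.act h (rmul M m a) = rmul M (M.carrier.act h m) (D.act h a) := by
  suffices e : M.carrier.act h ∘ₗ rmul M m = rmul M (M.carrier.act h m) ∘ₗ D.act h from
    LinearMap.congr_fun e a
  refine ext_single fun f => ?_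
  have := M.act.lin_act h (m ⊗ₜ Finsupp.single f (1 : k))
  refine this.symm.trans ?_
  change M.act.lin (tensorAct M.carrier D.obj h _) = _
  rw [tensorAct_tmul h hm (D.obj_pr_single f), NormCocycle.tensorTwist_one_left, Units.val_one,
    one_smul]
  rfl

/-- The first scalar comes from the associator, the second from the product in `A`. For `g ≠ 1` only
their invertibility matters later. -/
theorem rmul_rmul_single {g : H} {m : M.carrier.carrier} (hm : M.carrier.pr g m = m) (f f' : F) :
    rmul M (rmul M m (Finsupp.single f 1)) (Finsupp.single f' 1) =
      (((α.toFun g f f')⁻¹ : kˣ) : k) • (D.γ f f' : k) • rmul M m (Finsupp.single (f * f') 1) := by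
  have := LinearMap.congr_fun (congrArg TwistedCenter.Hom.lin M.act_act)
    ((m ⊗ₜ Finsupp.single f (1 : k)) ⊗ₜ Finsupp.single f' (1 : k))
  refine Eq.trans this ?_
  change M.act.lin (TensorProduct.map LinearMap.id D.mulLin (assocLin M.carrier D.obj D.obj _)) = _
  rw [assocLin_tmul hm (D.obj_pr_single f) (D.obj_pr_single f'), map_smul, map_smul,
    TensorProduct.map_tmul, mulLin_single, TensorProduct.tmul_smul, map_smul]
  rfl

/-- Since `α(1, -, -) = 1`, a degree `1` element makes `a ↦ m a` strictly compatible with right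
multiplication. -/
theorem rmul_rmul_of_pr_one {m : M.carrier.carrier} (hm : M.carrier.pr 1 m = m) (a b : F →₀ k) :
    rmul M (rmul M m a) b = rmul M m (D.mulLin (a ⊗ₜ b)) := by
  suffices e : TensorProduct.lift (rmul M ∘ₗ rmul M m) = rmul M m ∘ₗ D.mulLin from
    LinearMap.congr_fun e (a ⊗ₜ b)
  refine ext_single₂ fun f f' => ?_
  rw [TensorProduct.lift.tmul, LinearMap.comp_apply, LinearMap.comp_apply,
    rmul_rmul_single M hm, mulLin_single, map_smul, α.one_left, inv_one, Units.val_one, one_smul]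

/-- The factor arises because the unit of `A` is `γ(1,1)⁻¹ e_1`, not `e_1`. -/
theorem rmul_single_one (m : M.carrier.carrier) :
    rmul M m (Finsupp.single 1 1) = (D.γ 1 1 : k) • m := by
  have := LinearMap.congr_fun (congrArg TwistedCenter.Hom.lin M.act_one) (m ⊗ₜ ULift.up (1 : k))
  change rmul M m (D.oneLin ⟨1⟩) = (1 : k) • m at this
  rw [oneLin_up, one_smul, one_smul, map_smul] at this
  conv_rhs => rw [← this]
  rw [smul_smul, Units.mul_inv, one_smul]

/-- Multiplying further by `e_{f⁻¹}` returns a nonzero multiple of `m`, so `e_f` acts injectively on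
each component. -/
theorem rmul_single_ne_zero {g : H} {m : M.carrier.carrier} (hm : M.carrier.pr g m = m) {f : F}
    (h0 : rmul M m (Finsupp.single f 1) = 0) : m = 0 := by
  have := rmul_rmul_single M hm f f⁻¹
  rw [h0, map_zero, LinearMap.zero_apply, mul_inv_cancel, rmul_single_one] at this
  simpa using this.symm

/-- Surjectivity of `M_1 → M_f`: the preimage is `m e_{f⁻¹}`, rescaled. -/
theorem exists_rmul_single_eq (f : F) {m : M.carrier.carrier} (hm : M.carrier.pr f m = m) :
    ∃ m', M.carrier.pr 1 m' = m' ∧ rmul M m' (Finsupp.single f 1) = m := by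
  have e := rmul_rmul_single M hm f⁻¹ f
  rw [inv_mul_cancel, rmul_single_one, smul_smul, smul_smul] at e
  have h1 := rmul_homog M hm (D.obj_pr_single f⁻¹)
  rw [InvMemClass.coe_inv, mul_inv_cancel] at h1
  -- The three factors come from reassociating, from `e_{f⁻¹} e_f`, and from `m e_1 = γ(1,1) m`.
  set c : kˣ := (α.toFun f (f⁻¹ : F) f)⁻¹ * D.γ f⁻¹ f * D.γ 1 1 with hc
  refine ⟨((c⁻¹ : kˣ) : k) • rmul M m (Finsupp.single f⁻¹ 1), by rw [map_smul, h1], ?_⟩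
  rw [map_smul, LinearMap.smul_apply, e, smul_smul, ← Units.val_mul,
    ← Units.val_mul, ← hc, Units.inv_mul, one_smul]

/-- A local module has trivial `F`-action in degree `1`. -/
theorem act_eq_of_isLocal (hM : M.IsLocal) (f : F) {m : M.carrier.carrier}
    (hm : M.carrier.pr 1 m = m) : M.carrier.act f m = m := by
  have hf := D.obj_pr_single f
  have := LinearMap.congr_fun (congrArg TwistedCenter.Hom.lin hM)
    (m ⊗ₜ Finsupp.single f (1 : k))
  change M.act.lin (braidLin D.obj M.carrier (braidLin M.carrier D.obj _)) = M.act.lin _ at this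
  -- The first braiding is a swap since `m` has degree `1`; the second applies `f` to `m`. Locality
  -- now reads `(f.m) e_f = m e_f`, and `e_f` can be cancelled.
  rw [braidLin_tmul hm, D.obj.act_one, Module.End.one_apply, braidLin_tmul hf] at this
  have h1 := act_homog (f : H) hm
  rw [mul_one, mul_inv_cancel] at h1
  rw [← sub_eq_zero]
  refine rmul_single_ne_zero (g := 1) M (f := f) (by rw [map_sub, h1, hm]) ?_
  rw [map_sub, LinearMap.sub_apply, sub_eq_zero]
  exact this

/-! ### Sufficiency: for `F = H` a basis of `M_1` splits `M` into copies of `A`. -/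

variable {n : ℕ}

/-- The map `Aⁿ → M`, `a ↦ ∑ bᵢ aᵢ`. -/
noncomputable def sumLin (b : Fin n → M.carrier.carrier) :
    (Fin n → (F →₀ k)) →ₗ[k] M.carrier.carrier :=
  ∑ i, rmul M (b i) ∘ₗ LinearMap.proj i

theorem sumLin_apply (b : Fin n → M.carrier.carrier) (a : Fin n → (F →₀ k)) :
    sumLin M b a = ∑ i, rmul M (b i) (a i) := by
  simp [sumLin]

theorem rmul_pr {m : M.carrier.carrier} (hm : M.carrier.pr 1 m = m) (g : H) (a : F →₀ k) :
    rmul M m (D.obj.pr g a) = M.carrier.pr g (rmul M m a) :=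
  pr_of_homog (X := D.obj) _ (fun h x hx => by
    have := rmul_homog M hm hx
    rwa [one_mul] at this) g a

/-- Multiplication by `e_f` is a bijection `M_1 → M_f`, and `F = H` ensures that every degree is
reached. Locality plays no role here; it enters only to make the map equivariant. -/
theorem sumLin_bijective (hF : ∀ h, h ∈ F)
    (b : Module.Basis (Fin n) k (LinearMap.range (M.carrier.pr 1))) :
    Function.Bijective (sumLin M fun i => (b i : M.carrier.carrier)) := by
  have hb : ∀ x : LinearMap.range (M.carrier.pr 1), M.carrier.pr 1 (x : M.carrier.carrier) = x := by
    rintro ⟨_, y, rfl⟩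
    exact M.carrier.pr_pr 1 y
  constructor
  · rw [injective_iff_map_eq_zero]
    intro a ha
    rw [sumLin_apply] at ha
    have hpr : ∀ (f : F) (a : F →₀ k), pr F f a = a f • Finsupp.single f (1 : k) := by
      intro f a
      suffices e : pr F f = LinearMap.toSpanSingleton k (F →₀ k) (Finsupp.single f 1) ∘ₗ
          Finsupp.lapply f from LinearMap.congr_fun e a
      refine ext_single fun f' => ?_
      by_cases hf : f' = f
      · subst hf; rw [pr_self]; simp
      · rw [pr_ne (fun e => hf (Subtype.ext e))]; simp [hf]
    -- The degree `f` part of the relation is `(∑ a_i(f) b_i) e_f = 0`, and `e_f` cancels.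
    have h1 : ∀ f : F, ∑ i, a i f • b i = 0 := by
      intro f
      have h2 := congrArg (M.carrier.pr f) ha
      rw [map_sum, map_zero] at h2
      refine Subtype.ext (rmul_single_ne_zero (g := 1) M (f := f) (hb _) ?_)
      rw [← h2]
      push_cast
      rw [map_sum, LinearMap.sum_apply]
      refine Finset.sum_congr rfl fun i _ => ?_
      rw [← rmul_pr M (hb _)]
      change _ = rmul M _ (pr F f (a i))
      rw [hpr, map_smul, map_smul, LinearMap.smul_apply]
    funext i
    ext f
    exact Fintype.linearIndependent_iff.1 b.linearIndependent _ (h1 f) i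
  · intro m
    have hs : ∀ g, M.carrier.pr g m ∈
        LinearMap.range (sumLin M fun i => (b i : M.carrier.carrier)) := by
      intro g
      obtain ⟨m', hm', e⟩ := exists_rmul_single_eq M ⟨g, hF g⟩ (M.carrier.pr_pr g m)
      -- The coordinates of `m'` in `M_1`, all placed on `e_g`, map to `m' e_g`.
      refine ⟨fun i => b.repr ⟨m', m', hm'⟩ i • Finsupp.single ⟨g, hF g⟩ 1, ?_⟩
      rw [← e, sumLin_apply]
      have h2 := congrArg Subtype.val (b.sum_repr ⟨m', m', hm'⟩)
      push_cast at h2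
      conv_rhs => rw [← h2]
      rw [map_sum, LinearMap.sum_apply]
      refine Finset.sum_congr rfl fun i _ => ?_
      rw [map_smul, map_smul, LinearMap.smul_apply]
    have := Submodule.sum_mem _ fun g (_ : g ∈ Finset.univ) => hs g
    rwa [M.carrier.sum_pr] at this

/-- The projections are the coordinates of `Φ⁻¹`; they are module morphisms because the inverse of a
structure-preserving bijection preserves the structure. -/
theorem isSumOfRegular_of_equiv (ι : Fin n → (RightModule.regular D.obj ⟶ M))
    (Φ : (Fin n → (F →₀ k)) ≃ₗ[k] M.carrier.carrier)
    (hΦ : ∀ a, Φ a = ∑ i, (ι i).hom.lin (a i)) : M.IsSumOfRegular := by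
  -- Operators intertwined by every `ι_i` are intertwined by the coordinates of `Φ⁻¹`. This is used
  -- three times: for the grading, for the `H`-action and for right multiplication by a fixed `c`.
  have hsymm : ∀ (x : M.carrier.carrier) (T : Module.End k (F →₀ k))
      (S : Module.End k M.carrier.carrier)
      (_ : ∀ i a, (ι i).hom.lin (T a) = S ((ι i).hom.lin a)) (i),
      Φ.symm (S x) i = T (Φ.symm x i) := by
    intro x T S hTS i
    obtain ⟨a, rfl⟩ := Φ.surjective x
    have : S (Φ a) = Φ fun j => T (a j) := by
      rw [hΦ, hΦ, map_sum]
      exact Finset.sum_congr rfl fun j _ => (hTS j _).symm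
    rw [this, Φ.symm_apply_apply, Φ.symm_apply_apply]
  obtain ⟨π, hπ⟩ : ∃ π : Fin n → (M ⟶ RightModule.regular D.obj),
      ∀ i x, (π i).hom.lin x = Φ.symm x i :=
    ⟨fun i =>
      { hom :=
          { lin := LinearMap.proj i ∘ₗ Φ.symm.toLinearMap
            lin_pr := fun g x => hsymm x (D.obj.pr g) (M.carrier.pr g)
              (fun j a => (ι j).hom.lin_pr g a) i
            lin_act := fun g x => hsymm x (D.act g) (M.carrier.act g)
              (fun j a => (ι j).hom.lin_act g a) i }
        comm := hom_ext (TensorProduct.ext' fun x c =>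
          hsymm x (D.mulLin ∘ₗ (TensorProduct.mk k _ _).flip c) ((rmul M).flip c)
            (fun j a => LinearMap.congr_fun (congrArg TwistedCenter.Hom.lin (ι j).comm)
              (a ⊗ₜ c)) i) }, fun _ _ => rfl⟩
  have hs : ∀ i (a : F →₀ k), Φ.symm ((ι i).hom.lin a) = Pi.single i a := by
    intro i a
    rw [LinearEquiv.symm_apply_eq, hΦ, Finset.sum_eq_single i]
    · rw [Pi.single_eq_same]
    · intro j _ hj
      rw [Pi.single_eq_of_ne hj]
      exact map_zero (ι j).hom.lin
    · simp
  refine ⟨n, ι, π, fun i => ?_, fun i j hij => ?_, ?_⟩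
  · refine hom_ext (LinearMap.ext fun a => ?_)
    have e : (Pi.single i a : Fin n → (F →₀ k)) i = a := Pi.single_eq_same i _
    exact (hπ i _).trans ((congrFun (hs i a) i).trans e)
  · refine hom_ext (LinearMap.ext fun a => ?_)
    have e : (Pi.single i a : Fin n → (F →₀ k)) j = 0 := Pi.single_eq_of_ne hij.symm _
    exact (hπ j _).trans ((congrFun (hs i a) j).trans e)
  · refine hom_ext (LinearMap.ext fun x => ?_)
    rw [sum_lin, LinearMap.sum_apply]
    conv_rhs => rw [← Φ.apply_symm_apply x, hΦ]
    exact Finset.sum_congr rfl fun i _ => congrArg (ι i).hom.lin (hπ i x)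

theorem isSumOfRegular_of_isLocal (hF : ∀ h, h ∈ F) (hM : M.IsLocal) : M.IsSumOfRegular := by
  have b := Module.finBasis k (LinearMap.range (M.carrier.pr 1))
  have hb : ∀ i, M.carrier.pr 1 (b i : M.carrier.carrier) = b i := by
    intro i
    obtain ⟨y, hy⟩ := (b i).2
    rw [← hy]
    exact M.carrier.pr_pr 1 y
  -- Locality is used here: with `F = H` the whole group fixes each `b_i`, so `h.(b_i a) = b_i
  -- (h.a)` and `a ↦ b_i a` is a morphism.
  have hact : ∀ h i, M.carrier.act h (b i : M.carrier.carrier) = b i := fun h i =>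
    act_eq_of_isLocal M hM ⟨h, hF h⟩ (hb i)
  refine isSumOfRegular_of_equiv M (fun i =>
    { hom :=
        { lin := rmul M (b i)
          lin_pr := fun g a => rmul_pr M (hb i) g a
          lin_act := fun g a => ?_ }
      comm := hom_ext (TensorProduct.ext' fun a c => (rmul_rmul_of_pr_one M (hb i) a c).symm) })
    (LinearEquiv.ofBijective _ (sumLin_bijective M hF b)) (sumLin_apply M _)
  have := act_rmul_of_pr_one M g (hb i) a
  rw [hact] at this
  exact this.symm

end

end EtaleDatum

theorem mainTheorem12 {k : Type u} [Field k] [CharZero k] {H : Type v} [Group H] [Fintype H]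
    (α : NormCocycle k H) (F : Subgroup H) [F.Normal] (D : EtaleDatum α F) :
    IsLagrangian D.obj ↔ F = ⊤ := by
  refine ⟨D.eq_top_of_isLagrangian, fun hF M hM => ?_⟩
  exact EtaleDatum.isSumOfRegular_of_isLocal M (fun h => hF ▸ Subgroup.mem_top h) hM
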